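/- Let $d\ge 2$, $N\ge d$, and let $X_1,\dots,X_N$ be i.i.d. random points in $\mathbb{R}^d$ whose common law is spherically symmetric, i.e. invariant under all linear isometries of $\mathbb{R}^d$. Let $X=(X^{(1)},\dots,X^{(d)})$ have this law, and put $F(x)=P(|X|\ge x)$ and $K(x)=P\bigl(\sqrt{(X^{(1)})^2+(X^{(2)})^2}>x\bigr)$. Let $\mathrm{dist}$ be the distance from the origin to the affine span of $X_1,\dots,X_d$, and $H(x)=P(\mathrm{dist}\ge x)$. For a nonincreasing function $f$ on $\mathbb{R}$, write $|\mathrm{d}f|$ for its Lebesgue--Stieltjes measure, and let $\int_x^\infty$ denote integration over $(x,\infty)$. If $P(X=0)=0$, then almost surely $X_1,\dots,X_d$ are affinely independent, so that their affine span is a hyperplane. For every $x>0$, and also for $x=0$ if $P(X=0)=0$, $$H(x)=\frac{2}{\pi}\int_x^{\infty}\arccos\frac{x}{y}\;|\mathrm{d}(K^d)(y)|,$$ and for every $x\ge 0$, $$K(x)=\int_x^{\infty}\Bigl(1-\frac{x^2}{y^2}\Bigr)^{\frac{d-2}{2}}|\mathrm{d}F(y)|.$$ -/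

import Mathlib

open MeasureTheory ProbabilityTheory Set

/-- A measure on `ℝ^d` is spherically symmetric if it is invariant under every linear isometry
of `ℝ^d` onto itself. -/
def IsSphericallySymmetric {d : ℕ} (μ : Measure (EuclideanSpace ℝ (Fin d))) : Prop :=
  ∀ g : EuclideanSpace ℝ (Fin d) ≃ₗᵢ[ℝ] EuclideanSpace ℝ (Fin d), μ.map g = μ

/-- The Lebesgue-Stieltjes measure `|df|` of a nonincreasing function `f` on the line,
that is, the measure with `|df| ((a, b]) = f (a+) - f (b+)`. -/
noncomputable def stieltjesOfAntitone (f : ℝ → ℝ) (hf : Antitone f) : Measure ℝ :=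
  hf.neg.stieltjesFunction.measure

/-- `F(x) = P(|X| ≥ x)` for a random point `X` with law `μ`. -/
noncomputable def radialTail {d : ℕ} (μ : Measure (EuclideanSpace ℝ (Fin d))) (x : ℝ) : ℝ :=
  μ.real {v | x ≤ ‖v‖}

/-- `K(x) = P(√((X⁽¹⁾)² + (X⁽²⁾)²) > x)` for a random point `X` with law `μ`. -/
noncomputable def planarTail {d : ℕ} (hd : 2 ≤ d) (μ : Measure (EuclideanSpace ℝ (Fin d)))
    (x : ℝ) : ℝ :=
  μ.real {v | x < √(v ⟨0, by omega⟩ ^ 2 + v ⟨1, by omega⟩ ^ 2)}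

/-- `λ_d(r) = (1 - r²)^((d - 2) / 2)`. -/
noncomputable def lambdaFun (d : ℕ) (r : ℝ) : ℝ :=
  (1 - r ^ 2) ^ (((d : ℝ) - 2) / 2)

/-- The distance from the origin to the flat spanned by the points `p 0, …, p (d - 1)`
(a hyperplane when they are affinely independent). -/
noncomputable def spanDist {d : ℕ} (p : Fin d → EuclideanSpace ℝ (Fin d)) : ℝ :=
  Metric.infDist 0 (affineSpan ℝ (Set.range p) : Set (EuclideanSpace ℝ (Fin d)))

/-- `H(x)`: the probability that the hyperplane spanned by the random points
`Y 0, …, Y (d - 1)` lies at distance at least `x` from the origin. -/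
noncomputable def hyperplaneTail {Ω : Type*} [MeasurableSpace Ω] (P : Measure Ω) {d : ℕ}
    (Y : Fin d → Ω → EuclideanSpace ℝ (Fin d)) (x : ℝ) : ℝ :=
  P.real {ω | x ≤ spanDist (fun i => Y i ω)}

theorem radialTail_antitone {d : ℕ} (μ : Measure (EuclideanSpace ℝ (Fin d)))
    [IsFiniteMeasure μ] : Antitone (radialTail μ) :=
  fun _ _ h => measureReal_mono fun _ hv => le_trans h hv

theorem planarTail_pow_antitone {d : ℕ} (hd : 2 ≤ d)
    (μ : Measure (EuclideanSpace ℝ (Fin d))) [IsFiniteMeasure μ] (n : ℕ) :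
    Antitone (fun y => planarTail hd μ y ^ n) :=
  fun _ _ h => pow_le_pow_left₀ measureReal_nonneg
    (measureReal_mono fun _ hv => lt_of_le_of_lt h hv) n

/-!
Write `w` for the vector with `⟪X i, w⟫ = 1` for all `i < d` (`dualVector`). The hyperplane
through the points is `{v | ⟪v, w⟫ = 1}`, at distance `‖w‖⁻¹` from the origin
(`spanDist_eq_of_det_ne_zero`). The formula for `H` says that this distance has the law of
`M * |cos θ|`, where `M` is the minimum of the norms of the projections of the `d` points to the plane
of the first two coordinates, with tail function `K^d`, and `θ` is an independent uniform angle
(`lintegral_dualVector_eq`).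

This identity in law is first checked for points `σ i • Y i` with standard Gaussian `Y i` and
constants `σ i > 0`. Then `w` solves `⟪Y i, w⟫ = c i` with `c i = 1 / σ i`. Mixing the equations
by an orthogonal matrix keeps the law of the `Y i` and turns `c` into `‖c‖` times the first
coordinate vector, so that the distance is distributed as `|N| / ‖c‖` with `N` standard normal
(`lintegral_dualVector_stdGaussian`). In polar coordinates `|N|` is `R * |cos θ|` with `R`
Rayleigh distributed, and the minimum of the Rayleigh variables `σ i * R i` is again distributed
as `R / ‖c‖` (`lintegral_minPlanarRadius_stdGaussian`).

The general case follows from two facts. For independent isotropic `X` and `Y` the vectors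
`‖Y‖ • X` and `‖X‖ • Y` have the same law (`map_norm_smul_swap`), so after a rescaling of the `X i` by
the norms of independent Gaussian vectors, the identity holds by the Gaussian case conditionally
on the `‖X i‖`. Such a rescaling, for all parameters `a i`, is a Laplace transform in several
variables, and it determines a bounded function of the scales almost everywhere, because measures
on a cube are determined by their moments (`measure_cube_ext`,
`ae_eq_of_lintegral_norm_stdGaussian`). By continuity in the scales the identity holds at scale
`1`. Continuity needs that the points are almost surely linearly independent unless one of them is
the origin (`ae_exists_eq_zero_or_det_ne_zero`), which also gives the affine independence.

The formula for `K` is proved by the same method with a single point (`measure_planarRadius_gt`);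
its Gaussian case is the substitution `r = √(s² + x²)`. Finally, the Lebesgue-Stieltjes measure of
a tail function is the law itself, whatever the convention at atoms (`stieltjesOfAntitone_eq`).
-/

/-! ### Isotropic measures and the exchange of radii -/

section Isotropic

variable {E : Type*} [NormedAddCommGroup E] [InnerProductSpace ℝ E]

theorem exists_linearIsometryEquiv_apply_eq {u v : E} (h : ‖u‖ = ‖v‖) :
    ∃ g : E ≃ₗᵢ[ℝ] E, g u = v :=
  ⟨_, Submodule.reflection_sub h⟩

variable [MeasurableSpace E] [BorelSpace E]

variable [FiniteDimensional ℝ E]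

theorem charFun_eq_of_norm_eq {μ : Measure E} (hμ : ∀ g : E ≃ₗᵢ[ℝ] E, μ.map g = μ)
    {s t : E} (h : ‖s‖ = ‖t‖) : charFun μ s = charFun μ t := by
  obtain ⟨g, hg⟩ := exists_linearIsometryEquiv_apply_eq h
  conv_rhs => rw [← hμ g]
  rw [charFun_apply, charFun_apply, integral_map g.continuous.aemeasurable (by fun_prop), ← hg]
  simp

theorem stdGaussian_map_linearIsometryEquiv (g : E ≃ₗᵢ[ℝ] E) :
    (stdGaussian E).map g = stdGaussian E :=
  stdGaussian_map g

/-- For independent isotropic `X` and `Y`, the vectors `‖Y‖ X` and `‖X‖ Y` have the same law: since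
`charFun` of an isotropic law depends on the norm only, both characteristic functions at `t` equal
`E exp (i ‖t‖ ⟪X, Y⟫)`. -/
theorem map_norm_smul_swap {μ ν : Measure E} [IsProbabilityMeasure μ] [IsProbabilityMeasure ν]
    (hμ : ∀ g : E ≃ₗᵢ[ℝ] E, μ.map g = μ) (hν : ∀ g : E ≃ₗᵢ[ℝ] E, ν.map g = ν) :
    (ν.prod μ).map (fun q => ‖q.1‖ • q.2) = (ν.prod μ).map (fun q => ‖q.2‖ • q.1) := by
  have m1 : Measurable fun q : E × E => ‖q.1‖ • q.2 := by fun_prop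
  have m2 : Measurable fun q : E × E => ‖q.2‖ • q.1 := by fun_prop
  have : IsProbabilityMeasure ((ν.prod μ).map (fun q => ‖q.1‖ • q.2)) :=
    Measure.isProbabilityMeasure_map m1.aemeasurable
  have : IsProbabilityMeasure ((ν.prod μ).map (fun q => ‖q.2‖ • q.1)) :=
    Measure.isProbabilityMeasure_map m2.aemeasurable
  apply Measure.ext_of_charFun
  ext t
  have int (f : E × E → ℝ) (hf : Measurable f) :
      Integrable (fun q => Complex.exp (f q * Complex.I)) (ν.prod μ) := by
    refine Integrable.of_bound (C := 1) (by fun_prop) (ae_of_all _ fun q => ?_)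
    rw [Complex.norm_exp_ofReal_mul_I]
  rw [charFun_apply, charFun_apply, integral_map m1.aemeasurable (by fun_prop),
    integral_map m2.aemeasurable (by fun_prop), integral_prod _ (int _ (by fun_prop)),
    integral_prod_symm _ (int _ (by fun_prop))]
  have e1 (y : E) : ∫ x, Complex.exp (inner ℝ (‖y‖ • x) t * Complex.I) ∂μ =
      ∫ x, Complex.exp ((‖t‖ * inner ℝ x y : ℝ) * Complex.I) ∂μ := by
    have := charFun_eq_of_norm_eq hμ (s := ‖y‖ • t) (t := ‖t‖ • y)
      (by simp [norm_smul, mul_comm])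
    simpa [charFun_apply, inner_smul_right, inner_smul_left] using this
  have e2 (x : E) : ∫ y, Complex.exp (inner ℝ (‖x‖ • y) t * Complex.I) ∂ν =
      ∫ y, Complex.exp ((‖t‖ * inner ℝ x y : ℝ) * Complex.I) ∂ν := by
    have := charFun_eq_of_norm_eq hν (s := ‖x‖ • t) (t := ‖t‖ • x)
      (by simp [norm_smul, mul_comm])
    simpa [charFun_apply, inner_smul_right, inner_smul_left, real_inner_comm] using this
  simp only [e1, e2]
  rw [← integral_prod (fun q : E × E => Complex.exp ((‖t‖ * inner ℝ q.2 q.1 : ℝ) * Complex.I))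
      (int (fun q => ‖t‖ * inner ℝ q.2 q.1) (by fun_prop)),
    ← integral_prod_symm (fun q : E × E => Complex.exp ((‖t‖ * inner ℝ q.2 q.1 : ℝ) * Complex.I))
      (int (fun q => ‖t‖ * inner ℝ q.2 q.1) (by fun_prop))]

/-- The exchange of radii for several independent pairs. -/
theorem lintegral_norm_smul_swap {μ ν : Measure E} [IsProbabilityMeasure μ]
    [IsProbabilityMeasure ν]
    (hμ : ∀ g : E ≃ₗᵢ[ℝ] E, μ.map g = μ) (hν : ∀ g : E ≃ₗᵢ[ℝ] E, ν.map g = ν)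
    {ι : Type*} [Fintype ι] {F : (ι → E) → ENNReal} (hF : Measurable F) :
    ∫⁻ y, ∫⁻ p, F (fun i => ‖y i‖ • p i) ∂Measure.pi (fun _ => μ) ∂Measure.pi (fun _ => ν) =
      ∫⁻ p, ∫⁻ y, F (fun i => ‖p i‖ • y i) ∂Measure.pi (fun _ => ν) ∂Measure.pi (fun _ => μ) := by
  have key (f : E × E → E) (hf : Measurable f) :
      ∫⁻ q, F (fun i => f (q.1 i, q.2 i))
        ∂((Measure.pi fun _ : ι => ν).prod (Measure.pi fun _ => μ)) =
      ∫⁻ z, F z ∂(Measure.pi fun _ => (ν.prod μ).map f) := by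
    have : IsProbabilityMeasure ((ν.prod μ).map f) :=
      Measure.isProbabilityMeasure_map hf.aemeasurable
    rw [← Measure.pi_map_pi (fun _ => hf.aemeasurable), lintegral_map hF (by fun_prop),
      ← (measurePreserving_arrowProdEquivProdArrow E E ι (fun _ => ν) (fun _ => μ)).lintegral_comp
        (by fun_prop)]
    rfl
  rw [← lintegral_prod (fun q : (ι → E) × (ι → E) => F fun i => ‖q.1 i‖ • q.2 i)
      (by fun_prop),
    ← lintegral_prod_symm (fun q : (ι → E) × (ι → E) => F fun i => ‖q.2 i‖ • q.1 i)
      (by fun_prop)]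
  rw [key (fun q => ‖q.1‖ • q.2) (by fun_prop), key (fun q => ‖q.2‖ • q.1) (by fun_prop),
    map_norm_smul_swap hμ hν]

end Isotropic

/-! ### The density of the standard Gaussian measure -/

section Density

variable (E : Type*) [NormedAddCommGroup E] [InnerProductSpace ℝ E]

/-- The density on `E` of the centred Gaussian law with covariance `a⁻¹ • id`. -/
noncomputable def gaussianDensity (a : ℝ) (v : E) : ℝ :=
  (2 * Real.pi / a) ^ (-((Module.finrank ℝ E : ℝ) / 2)) * Real.exp (-(a / 2) * ‖v‖ ^ 2)

variable {E}

theorem gaussianDensity_pos {a : ℝ} (ha : 0 < a) (v : E) : 0 < gaussianDensity E a v := by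
  unfold gaussianDensity; positivity

variable [MeasurableSpace E] [BorelSpace E]

@[fun_prop]
theorem measurable_gaussianDensity (a : ℝ) : Measurable (gaussianDensity E a) := by
  unfold gaussianDensity; fun_prop

variable [FiniteDimensional ℝ E]

theorem integral_gaussianDensity {a : ℝ} (ha : 0 < a) : ∫ v, gaussianDensity E a v = 1 := by
  simp only [gaussianDensity]
  rw [integral_const_mul, GaussianFourier.integral_rexp_neg_mul_sq_norm (by positivity),
    Real.rpow_neg (by positivity),
    show Real.pi / (a / 2) = 2 * Real.pi / a by field_simp]
  exact inv_mul_cancel₀ (by positivity)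

theorem integrable_gaussianDensity {a : ℝ} (ha : 0 < a) : Integrable (gaussianDensity E a) :=
  .of_integral_ne_zero (by rw [integral_gaussianDensity ha]; simp)

theorem isProbabilityMeasure_withDensity_gaussianDensity {a : ℝ} (ha : 0 < a) :
    IsProbabilityMeasure
      ((volume : Measure E).withDensity fun v => ENNReal.ofReal (gaussianDensity E a v)) := by
  constructor
  rw [withDensity_apply _ .univ, Measure.restrict_univ,
    ← ofReal_integral_eq_lintegral_ofReal (integrable_gaussianDensity ha)
      (ae_of_all _ fun v => (gaussianDensity_pos ha v).le), integral_gaussianDensity ha]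
  simp

theorem map_smul_stdGaussian {a : ℝ} (ha : 0 < a) :
    (stdGaussian E).map (fun v => (√a)⁻¹ • v) =
      (volume : Measure E).withDensity fun v => ENNReal.ofReal (gaussianDensity E a v) := by
  have := isProbabilityMeasure_withDensity_gaussianDensity (E := E) ha
  have : IsProbabilityMeasure ((stdGaussian E).map (fun v => (√a)⁻¹ • v)) :=
    Measure.isProbabilityMeasure_map (by fun_prop)
  apply Measure.ext_of_charFun
  ext t
  rw [charFun_map_smul, charFun_stdGaussian, charFun_apply,
    integral_withDensity_eq_integral_toReal_smul (by fun_prop) (by simp)]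
  have h1 (v : E) : (ENNReal.ofReal (gaussianDensity E a v)).toReal •
      Complex.exp (inner ℝ v t * Complex.I) =
      ((2 * Real.pi / a : ℝ) ^ (-((Module.finrank ℝ E : ℝ) / 2)) : ℝ) *
        Complex.exp (-((a / 2 : ℝ) : ℂ) * ‖v‖ ^ 2 + Complex.I * inner ℝ t v) := by
    rw [ENNReal.toReal_ofReal (gaussianDensity_pos ha v).le, gaussianDensity, Complex.exp_add,
      real_inner_comm, Complex.real_smul]
    push_cast
    ring_nf
  simp only [h1]
  rw [integral_const_mul, GaussianFourier.integral_cexp_neg_mul_sq_norm_add (by simpa using ha)]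
  have h2 : ((Real.pi : ℂ) / ((a / 2 : ℝ) : ℂ)) ^ ((Module.finrank ℝ E : ℂ) / 2) =
      ((2 * Real.pi / a) ^ ((Module.finrank ℝ E : ℝ) / 2) : ℝ) := by
    rw [Complex.ofReal_cpow (by positivity)]
    push_cast
    congr 1
    field_simp
  rw [h2, ← mul_assoc, ← Complex.ofReal_mul, ← Real.rpow_add (by positivity)]
  simp only [neg_add_cancel, Real.rpow_zero, Complex.ofReal_one, one_mul]
  congr 1
  have h3 : ‖(√a)⁻¹ • t‖ ^ 2 = a⁻¹ * ‖t‖ ^ 2 := by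
    rw [norm_smul, mul_pow, norm_inv, inv_pow, Real.norm_of_nonneg (Real.sqrt_nonneg a),
      Real.sq_sqrt ha.le]
  have : (a : ℂ) ≠ 0 := by exact_mod_cast ha.ne'
  rw [← Complex.ofReal_pow, h3, Complex.I_sq]
  push_cast
  field_simp
  norm_num

theorem stdGaussian_eq_withDensity :
    stdGaussian E =
      (volume : Measure E).withDensity fun v => ENNReal.ofReal (gaussianDensity E 1 v) := by
  rw [← map_smul_stdGaussian one_pos]
  simp

/-- Tilting the standard Gaussian law by `exp (-n ‖v‖² / 2)` rescales it, up to a constant. -/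
theorem exists_withDensity_stdGaussian (n : ℕ) : ∃ C : ENNReal, C ≠ 0 ∧ C ≠ ⊤ ∧
    (stdGaussian E).map (fun v => (√(n + 1 : ℝ))⁻¹ • v) =
      (stdGaussian E).withDensity fun v => C * ENNReal.ofReal (Real.exp (-‖v‖ ^ 2 / 2)) ^ n := by
  have hn : (0 : ℝ) < n + 1 := by positivity
  refine ⟨ENNReal.ofReal ((n + 1 : ℝ) ^ ((Module.finrank ℝ E : ℝ) / 2)), ?_, by simp, ?_⟩
  · simp only [ne_eq, ENNReal.ofReal_eq_zero, not_le]; positivity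
  rw [map_smul_stdGaussian hn, stdGaussian_eq_withDensity, ← withDensity_mul _ (by fun_prop)
    (by fun_prop)]
  congr 1
  ext v
  simp only [Pi.mul_apply]
  rw [← ENNReal.ofReal_pow (by positivity), ← ENNReal.ofReal_mul (by positivity),
    ← ENNReal.ofReal_mul (gaussianDensity_pos one_pos v).le, gaussianDensity, gaussianDensity,
    ← Real.exp_nat_mul, div_one]
  congr 1
  rw [mul_mul_mul_comm, ← Real.exp_add, Real.div_rpow (by positivity) hn.le,
    Real.rpow_neg hn.le, div_inv_eq_mul]
  congr 2
  ring

theorem volume_absolutelyContinuous_stdGaussian : (volume : Measure E) ≪ stdGaussian E := by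
  rw [stdGaussian_eq_withDensity]
  refine withDensity_absolutelyContinuous' (by fun_prop) (ae_of_all _ fun v => ?_)
  simpa using gaussianDensity_pos one_pos v

theorem stdGaussian_absolutelyContinuous_volume : stdGaussian E ≪ (volume : Measure E) := by
  rw [stdGaussian_eq_withDensity]
  exact withDensity_absolutelyContinuous _ _

end Density

/-! ### Laplace inversion in several variables -/

theorem pi_withDensity {ι X : Type*} [Fintype ι] [MeasurableSpace X] (ν : Measure X)
    [IsProbabilityMeasure ν] {f : ι → X → ENNReal} (hf : ∀ i, Measurable (f i))
    [∀ i, SigmaFinite (ν.withDensity (f i))] :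
    Measure.pi (fun i => ν.withDensity (f i)) =
      (Measure.pi fun _ => ν).withDensity fun x => ∏ i, f i (x i) := by
  classical
  refine Measure.pi_eq fun s hs => ?_
  rw [withDensity_apply _ (.univ_pi hs), ← lintegral_indicator (.univ_pi hs)]
  have h1 (x : ι → X) : (univ.pi s).indicator (fun x => ∏ i, f i (x i)) x =
      ∏ i, (s i).indicator (f i) (x i) := by
    by_cases hx : x ∈ univ.pi s
    · rw [indicator_of_mem hx]
      exact Finset.prod_congr rfl fun i _ => (indicator_of_mem (hx i trivial) _).symm
    · rw [indicator_of_notMem hx]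
      simp only [mem_univ_pi, not_forall] at hx
      obtain ⟨i, hi⟩ := hx
      exact (Finset.prod_eq_zero (Finset.mem_univ i) (indicator_of_notMem hi _)).symm
  simp only [h1]
  have hm (i : ι) : Measurable ((s i).indicator (f i)) := (hf i).indicator (hs i)
  have hind := iIndepFun_pi (μ := fun _ : ι => ν) (X := fun i => (s i).indicator (f i))
    fun i => (hm i).aemeasurable
  rw [lintegral_prod_eq_prod_lintegral_of_indepFun _ _ hind
    fun i => (hm i).comp (measurable_pi_apply i)]
  refine Finset.prod_congr rfl fun i _ => ?_
  rw [withDensity_apply _ (hs i), ← lintegral_indicator (hs i)]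
  exact (measurePreserving_eval (fun _ : ι => ν) i).lintegral_comp (hm i)

/-- A finite measure on the cube `[0, 1]^ι` is determined by its moments (Stone-Weierstrass). -/
theorem measure_cube_ext {ι : Type*} [Fintype ι] {m₁ m₂ : Measure (ι → unitInterval)}
    [IsFiniteMeasure m₁] [IsFiniteMeasure m₂]
    (h : ∀ n : ι → ℕ, ∫⁻ z, ∏ i, ENNReal.ofReal (z i) ^ n i ∂m₁ =
      ∫⁻ z, ∏ i, ENNReal.ofReal (z i) ^ n i ∂m₂) : m₁ = m₂ := by
  let c (i : ι) : BoundedContinuousFunction (ι → unitInterval) ℝ :=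
    BoundedContinuousFunction.mkOfCompact ⟨fun z => (z i : ℝ), by fun_prop⟩
  let A : StarSubalgebra ℝ (BoundedContinuousFunction (ι → unitInterval) ℝ) :=
    { (MvPolynomial.aeval (R := ℝ) c).range with
      star_mem' := fun {a} ha => by
        have : star a = a := by ext; simp
        rwa [this] }
  refine ext_of_forall_mem_subalgebra_integral_eq_of_polish (𝕜 := ℝ) (A := A) ?_ ?_
  · intro x y hxy
    obtain ⟨i, hi⟩ := Function.ne_iff.mp hxy
    refine ⟨fun z => (z i : ℝ), ⟨_, ⟨c i, ⟨MvPolynomial.X i, by simp⟩, rfl⟩, rfl⟩, ?_⟩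
    exact fun h => hi (Subtype.ext h)
  · rintro g ⟨p, rfl⟩
    have hint (m : Measure (ι → unitInterval)) [IsFiniteMeasure m] (q : MvPolynomial ι ℝ) :
        Integrable (fun z => MvPolynomial.aeval c q z) m :=
      BoundedContinuousFunction.integrable m _
    induction p using MvPolynomial.induction_on' with
    | monomial u a =>
      have e (z : ι → unitInterval) : MvPolynomial.aeval c (MvPolynomial.monomial u a) z =
          a * (∏ i, ENNReal.ofReal (z i) ^ u i).toReal := by
        rw [MvPolynomial.aeval_monomial, Finsupp.prod_fintype _ _ (by simp),
          ENNReal.toReal_prod]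
        simp only [BoundedContinuousFunction.coe_mul, Pi.mul_apply,
          BoundedContinuousFunction.coe_prod, Finset.prod_apply, ENNReal.toReal_pow,
          ENNReal.toReal_ofReal (z _).2.1]
        rfl
      have hmeas : Measurable fun z : ι → unitInterval => ∏ i, ENNReal.ofReal (z i) ^ u i :=
        Finset.measurable_prod _ fun i _ =>
          (measurable_subtype_coe.comp (measurable_pi_apply i)).ennreal_ofReal.pow_const _
      have e' (m : Measure (ι → unitInterval)) [IsFiniteMeasure m] :
          ∫ z, a * (∏ i, ENNReal.ofReal (z i) ^ u i).toReal ∂m =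
          a * (∫⁻ z, ∏ i, ENNReal.ofReal (z i) ^ u i ∂m).toReal := by
        rw [integral_const_mul, integral_toReal hmeas.aemeasurable
          (ae_of_all _ fun z => ENNReal.prod_lt_top fun i _ => by simp)]
      change ∫ z, MvPolynomial.aeval c (MvPolynomial.monomial u a) z ∂m₁ =
        ∫ z, MvPolynomial.aeval c (MvPolynomial.monomial u a) z ∂m₂
      simp only [e, e', h]
    | add p q hp hq =>
      have e (m : Measure (ι → unitInterval)) [IsFiniteMeasure m] :
          ∫ z, MvPolynomial.aeval c (p + q) z ∂m =
          ∫ z, MvPolynomial.aeval c p z ∂m + ∫ z, MvPolynomial.aeval c q z ∂m := by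
        rw [← integral_add (hint m p) (hint m q), map_add]
        rfl
      exact (e m₁).trans ((congrArg₂ (· + ·) hp hq).trans (e m₂).symm)

section Inversion

variable {E : Type*} [NormedAddCommGroup E] [InnerProductSpace ℝ E] [FiniteDimensional ℝ E]
  [MeasurableSpace E] [BorelSpace E] {ι : Type*} [Fintype ι] {h₁ h₂ : (ι → ℝ) → ENNReal}
  {C : ENNReal}

/-- Rescaling independent Gaussian vectors `Y i` amounts to weighting the law by
`∏ i, exp (-n i * ‖Y i‖² / 2)`. Hence a bounded function of the norms is determined almost
everywhere by its means over all rescalings. -/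
theorem ae_eq_of_lintegral_norm_stdGaussian (m1 : Measurable h₁) (m2 : Measurable h₂)
    (hC : C ≠ ⊤) (b1 : ∀ s, h₁ s ≤ C) (b2 : ∀ s, h₂ s ≤ C)
    (h : ∀ a : ι → ℝ, (∀ i, 0 < a i) →
      ∫⁻ y, h₁ (fun i => a i * ‖y i‖) ∂Measure.pi (fun _ : ι => stdGaussian E) =
      ∫⁻ y, h₂ (fun i => a i * ‖y i‖) ∂Measure.pi (fun _ : ι => stdGaussian E)) :
    ∀ᵐ y ∂Measure.pi (fun _ : ι => stdGaussian E),
      h₁ (fun i => ‖y i‖) = h₂ (fun i => ‖y i‖) := by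
  set Γ := Measure.pi (fun _ : ι => stdGaussian E) with hΓ
  -- `r ↦ exp (-r² / 2)` maps radii into `[0, 1]` turning the weights into monomials; `L` inverts it
  let z (y : ι → E) (i : ι) : unitInterval :=
    ⟨Real.exp (-‖y i‖ ^ 2 / 2), (Real.exp_pos _).le, by
      rw [Real.exp_le_one_iff]
      have := sq_nonneg ‖y i‖
      linarith⟩
  have hz : Measurable z := by
    refine measurable_pi_lambda _ fun i => Measurable.subtype_mk ?_
    fun_prop
  let L (w : ι → unitInterval) (i : ι) : ℝ := √(-2 * Real.log (w i))
  have hL : Measurable L := by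
    refine measurable_pi_lambda _ fun i => ?_
    have : Measurable fun w : ι → unitInterval => (w i : ℝ) :=
      measurable_subtype_coe.comp (measurable_pi_apply i)
    fun_prop
  have hLz (y : ι → E) : L (z y) = fun i => ‖y i‖ := by
    ext i
    simp only [L, z, Real.log_exp]
    rw [show -2 * (-‖y i‖ ^ 2 / 2) = ‖y i‖ ^ 2 by ring, Real.sqrt_sq (norm_nonneg _)]
  have fin {k : (ι → ℝ) → ENNReal} (hk : ∀ s, k s ≤ C) :
      ∫⁻ w, k (L w) ∂(Γ.map z) ≠ ⊤ := by
    have : IsProbabilityMeasure (Γ.map z) := Measure.isProbabilityMeasure_map hz.aemeasurable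
    refine ne_top_of_le_ne_top hC ((lintegral_mono fun w => hk (L w)).trans ?_)
    simp
  have weight (n : ι → ℕ) : ∃ K : ENNReal, K ≠ 0 ∧ K ≠ ⊤ ∧ ∀ k : (ι → ℝ) → ENNReal,
      Measurable k → K * ∫⁻ w, k (L w) * ∏ i, ENNReal.ofReal (w i) ^ n i ∂(Γ.map z) =
        ∫⁻ y, k (fun i => (√(n i + 1 : ℝ))⁻¹ * ‖y i‖) ∂Γ := by
    choose c hc0 hct hc using fun i => exists_withDensity_stdGaussian (E := E) (n i)
    refine ⟨∏ i, c i, Finset.prod_ne_zero_iff.mpr fun i _ => hc0 i,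
      ENNReal.prod_ne_top fun i _ => hct i, fun k hk => ?_⟩
    have p (i : ι) : IsProbabilityMeasure
        ((stdGaussian E).map fun v => (√(n i + 1 : ℝ))⁻¹ • v) :=
      Measure.isProbabilityMeasure_map (by fun_prop)
    have p' (i : ι) : SigmaFinite ((stdGaussian E).withDensity
        fun v => c i * ENNReal.ofReal (Real.exp (-‖v‖ ^ 2 / 2)) ^ n i) := by
      rw [← hc i]; infer_instance
    have e1 : ∫⁻ y, k (fun i => (√(n i + 1 : ℝ))⁻¹ * ‖y i‖) ∂Γ =
        ∫⁻ y, k (fun i => ‖y i‖) ∂(Measure.pi fun i =>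
          (stdGaussian E).map fun v => (√(n i + 1 : ℝ))⁻¹ • v) := by
      rw [← Measure.pi_map_pi (fun i => by fun_prop), lintegral_map (by fun_prop) (by fun_prop)]
      simp [norm_smul, abs_of_nonneg]
      rfl
    rw [e1, lintegral_map (by fun_prop) hz]
    simp only [hc]
    rw [pi_withDensity _ (fun i => by fun_prop), lintegral_withDensity_eq_lintegral_mul _
      (by fun_prop) (by fun_prop), ← lintegral_const_mul _ (by fun_prop)]
    refine lintegral_congr fun y => ?_
    simp only [Pi.mul_apply, hLz, Finset.prod_mul_distrib, z]
    ring
  have key : (Γ.map z).withDensity (fun w => h₁ (L w)) =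
      (Γ.map z).withDensity (fun w => h₂ (L w)) := by
    have f1 := isFiniteMeasure_withDensity (fin b1)
    have f2 := isFiniteMeasure_withDensity (fin b2)
    refine measure_cube_ext fun n => ?_
    rw [lintegral_withDensity_eq_lintegral_mul _ (by fun_prop) (by fun_prop),
      lintegral_withDensity_eq_lintegral_mul _ (by fun_prop) (by fun_prop)]
    obtain ⟨K, hK0, hKt, hK⟩ := weight n
    have := (hK h₁ m1).trans ((h _ fun i => by positivity).trans (hK h₂ m2).symm)
    exact (ENNReal.mul_right_inj hK0 hKt).mp this
  rw [withDensity_eq_iff (by fun_prop) (by fun_prop) (fin b1)] at key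
  filter_upwards [ae_of_ae_map hz.aemeasurable key] with y hy
  simpa only [hLz] using hy

/-- For functions that are continuous on the positive orthant, equality almost everywhere becomes
equality everywhere, since the Gaussian law charges every nonempty open set. -/
theorem eq_one_of_lintegral_norm_stdGaussian [Nontrivial E]
    (m1 : Measurable h₁) (m2 : Measurable h₂)
    (hC : C ≠ ⊤) (b1 : ∀ s, h₁ s ≤ C) (b2 : ∀ s, h₂ s ≤ C)
    (c1 : ContinuousOn h₁ {s | ∀ i, 0 < s i}) (c2 : ContinuousOn h₂ {s | ∀ i, 0 < s i})
    (h : ∀ a : ι → ℝ, (∀ i, 0 < a i) →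
      ∫⁻ y, h₁ (fun i => a i * ‖y i‖) ∂Measure.pi (fun _ : ι => stdGaussian E) =
      ∫⁻ y, h₂ (fun i => a i * ‖y i‖) ∂Measure.pi (fun _ : ι => stdGaussian E)) :
    h₁ 1 = h₂ 1 := by
  have hae := ae_eq_of_lintegral_norm_stdGaussian m1 m2 hC b1 b2 h
  have : (stdGaussian E).IsOpenPosMeasure :=
    volume_absolutelyContinuous_stdGaussian.isOpenPosMeasure
  by_contra hne
  have hpos : IsOpen {s : ι → ℝ | ∀ i, 0 < s i} := by
    simp only [ofPred_forall]
    exact isOpen_iInter_of_finite fun i => isOpen_lt continuous_const (continuous_apply i)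
  have hU := (c1.prodMk c2).isOpen_inter_preimage hpos isClosed_diagonal.isOpen_compl
  have hN : Continuous fun (y : ι → E) (i : ι) => ‖y i‖ := by fun_prop
  obtain ⟨e, he⟩ := exists_norm_eq E zero_le_one
  have hone : (1 : ι → ℝ) = fun _ => ‖e‖ := by ext; simp [he]
  rw [hone] at hne
  have h0 := (hU.preimage hN).measure_pos (Measure.pi (fun _ : ι => stdGaussian E))
    ⟨fun _ => e, fun i => by simp [he], fun h => hne h⟩
  exact h0.ne' (measure_mono_null (fun y hy h => hy.2 h) hae)

end Inversion

/-! ### The hyperplane through `d` points -/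

section Hyperplane

variable {d : ℕ}

/-- The square matrix whose rows are the given points. -/
def rowMatrix (p : Fin d → EuclideanSpace ℝ (Fin d)) : Matrix (Fin d) (Fin d) ℝ :=
  Matrix.of fun i j => p i j

/-- The vector `w` with `⟪p i, w⟫ = c i` for all `i`; it is `0` if the points `p i` are linearly
dependent. For `c = 1` this is the normal vector of the hyperplane `{v | ⟪v, w⟫ = 1}` through the
points `p i`. -/
noncomputable def dualVector (p : Fin d → EuclideanSpace ℝ (Fin d)) (c : Fin d → ℝ) :
    EuclideanSpace ℝ (Fin d) :=
  WithLp.toLp 2 ((rowMatrix p)⁻¹.mulVec c)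

theorem rowMatrix_mulVec (p : Fin d → EuclideanSpace ℝ (Fin d)) (w : EuclideanSpace ℝ (Fin d))
    (i : Fin d) : (rowMatrix p).mulVec w i = inner ℝ (p i) w := by
  simp [rowMatrix, Matrix.mulVec, dotProduct, PiLp.inner_apply, mul_comm]

theorem inner_dualVector {p : Fin d → EuclideanSpace ℝ (Fin d)} (hp : (rowMatrix p).det ≠ 0)
    (c : Fin d → ℝ) (i : Fin d) : inner ℝ (p i) (dualVector p c) = c i := by
  rw [← rowMatrix_mulVec, dualVector, Matrix.mulVec_mulVec,
    Matrix.mul_nonsing_inv _ (isUnit_iff_ne_zero.mpr hp), Matrix.one_mulVec]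

theorem eq_dualVector {p : Fin d → EuclideanSpace ℝ (Fin d)} (hp : (rowMatrix p).det ≠ 0)
    {c : Fin d → ℝ} {w : EuclideanSpace ℝ (Fin d)} (hw : ∀ i, inner ℝ (p i) w = c i) :
    w = dualVector p c := by
  have : c = (rowMatrix p).mulVec w := by ext i; rw [rowMatrix_mulVec, hw]
  rw [this, dualVector, Matrix.mulVec_mulVec,
    Matrix.nonsing_inv_mul _ (isUnit_iff_ne_zero.mpr hp), Matrix.one_mulVec]

theorem dualVector_eq_zero {p : Fin d → EuclideanSpace ℝ (Fin d)} (hp : (rowMatrix p).det = 0)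
    (c : Fin d → ℝ) : dualVector p c = 0 := by
  rw [dualVector, Matrix.nonsing_inv_apply_not_isUnit _ (by simp [hp])]
  simp

theorem rowMatrix_smul (s : Fin d → ℝ) (p : Fin d → EuclideanSpace ℝ (Fin d)) :
    rowMatrix (fun i => s i • p i) = Matrix.diagonal s * rowMatrix p := by
  ext i j
  simp [rowMatrix, Matrix.diagonal_mul]

theorem det_rowMatrix_smul (s : Fin d → ℝ) (p : Fin d → EuclideanSpace ℝ (Fin d)) :
    (rowMatrix (fun i => s i • p i)).det = (∏ i, s i) * (rowMatrix p).det := by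
  rw [rowMatrix_smul, Matrix.det_mul, Matrix.det_diagonal]

theorem dualVector_smul {s : Fin d → ℝ} (hs : ∀ i, s i ≠ 0)
    (p : Fin d → EuclideanSpace ℝ (Fin d)) (c : Fin d → ℝ) :
    dualVector (fun i => s i • p i) c = dualVector p (fun i => c i / s i) := by
  by_cases hp : (rowMatrix p).det = 0
  · rw [dualVector_eq_zero hp, dualVector_eq_zero (by rw [det_rowMatrix_smul, hp, mul_zero])]
  · refine eq_dualVector hp fun i => ?_
    have h := inner_dualVector (p := fun i => s i • p i) (c := c)
      (by
        rw [det_rowMatrix_smul]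
        exact mul_ne_zero (Finset.prod_ne_zero_iff.mpr fun i _ => hs i) hp) i
    rw [real_inner_smul_left] at h
    rw [eq_div_iff (hs i), mul_comm, h]

theorem rowMatrix_mix (O : Matrix (Fin d) (Fin d) ℝ) (p : Fin d → EuclideanSpace ℝ (Fin d)) :
    rowMatrix (fun i => ∑ j, O i j • p j) = O * rowMatrix p := by
  ext i j
  simp [rowMatrix, Matrix.mul_apply]

theorem dualVector_mix {O : Matrix (Fin d) (Fin d) ℝ} (hO : O.det ≠ 0)
    (p : Fin d → EuclideanSpace ℝ (Fin d)) (c : Fin d → ℝ) :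
    dualVector (fun i => ∑ j, O i j • p j) (O.mulVec c) = dualVector p c := by
  rw [dualVector, rowMatrix_mix, Matrix.mul_inv_rev, Matrix.mulVec_mulVec, Matrix.mul_assoc,
    Matrix.nonsing_inv_mul _ (isUnit_iff_ne_zero.mpr hO), Matrix.mul_one, dualVector]

theorem dualVector_smul_right (p : Fin d → EuclideanSpace ℝ (Fin d)) (a : ℝ) (c : Fin d → ℝ) :
    dualVector p (a • c) = a • dualVector p c := by
  simp [dualVector, Matrix.mulVec_smul]

theorem continuous_rowMatrix :
    Continuous (rowMatrix : (Fin d → EuclideanSpace ℝ (Fin d)) → _) := by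
  refine continuous_matrix fun i j => ?_
  simp only [rowMatrix, Matrix.of_apply]
  fun_prop

theorem measurable_det_rowMatrix :
    Measurable fun p : Fin d → EuclideanSpace ℝ (Fin d) => (rowMatrix p).det :=
  continuous_rowMatrix.matrix_det.measurable

theorem measurable_dualVector (c : Fin d → ℝ) :
    Measurable fun p : Fin d → EuclideanSpace ℝ (Fin d) => dualVector p c := by
  have h : (fun p : Fin d → EuclideanSpace ℝ (Fin d) => dualVector p c) =
      fun p => ((rowMatrix p).det)⁻¹ • WithLp.toLp 2 ((rowMatrix p).adjugate.mulVec c) := by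
    ext p
    simp [dualVector, Matrix.inv_def, Matrix.smul_mulVec]
  rw [h]
  refine measurable_det_rowMatrix.inv.smul (Continuous.measurable ?_)
  exact (PiLp.continuous_toLp 2 _).comp
    (continuous_rowMatrix.matrix_adjugate.matrix_mulVec continuous_const)

theorem continuous_dualVector_right (p : Fin d → EuclideanSpace ℝ (Fin d)) :
    Continuous (dualVector p) :=
  (PiLp.continuous_toLp 2 _).comp (continuous_const.matrix_mulVec continuous_id)

theorem dualVector_ne_zero [NeZero d] {p : Fin d → EuclideanSpace ℝ (Fin d)}
    (hp : (rowMatrix p).det ≠ 0) {c : Fin d → ℝ} (hc : c ≠ 0) : dualVector p c ≠ 0 := by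
  intro h
  apply hc
  ext i
  rw [← inner_dualVector hp c i, h, inner_zero_right, Pi.zero_apply]

theorem affineIndependent_of_det_ne_zero {p : Fin d → EuclideanSpace ℝ (Fin d)}
    (hp : (rowMatrix p).det ≠ 0) : AffineIndependent ℝ p := by
  apply LinearIndependent.affineIndependent
  have h : LinearIndependent ℝ (rowMatrix p).row :=
    Matrix.linearIndependent_rows_iff_isUnit.mpr
      ((Matrix.isUnit_iff_isUnit_det _).mpr (isUnit_iff_ne_zero.mpr hp))
  exact LinearIndependent.of_comp (WithLp.linearEquiv 2 ℝ (Fin d → ℝ)).toLinearMap h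

/-- The hyperplane through linearly independent points `p i` is `{v | ⟪v, w⟫ = 1}` for
`w = dualVector p 1`, at distance `‖w‖⁻¹` from the origin. -/
theorem spanDist_eq_of_det_ne_zero [NeZero d] {p : Fin d → EuclideanSpace ℝ (Fin d)}
    (hp : (rowMatrix p).det ≠ 0) : spanDist p = ‖dualVector p 1‖⁻¹ := by
  set w := dualVector p 1 with hw
  have hw0 : w ≠ 0 := dualVector_ne_zero hp one_ne_zero
  have hwpos : 0 < ‖w‖ := norm_pos_iff.mpr hw0
  have hin (i : Fin d) : inner ℝ (p i) w = 1 := inner_dualVector hp 1 i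
  have hplane : ∀ v ∈ affineSpan ℝ (range p), inner ℝ v w = 1 := by
    intro v hv
    obtain ⟨a, ha, rfl⟩ := eq_affineCombination_of_mem_affineSpan_of_fintype hv
    rw [Finset.affineCombination_eq_linear_combination _ _ _ ha, sum_inner]
    simp only [real_inner_smul_left, hin, mul_one, ha]
  have hne : (affineSpan ℝ (range p) : Set (EuclideanSpace ℝ (Fin d))).Nonempty :=
    (range_nonempty p).affineSpan ℝ
  -- `w / ‖w‖²` is the foot of the perpendicular from the origin
  have hfoot : (‖w‖ ^ 2)⁻¹ • w ∈ affineSpan ℝ (range p) := by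
    set a : Fin d → ℝ := Matrix.vecMul ((‖w‖ ^ 2)⁻¹ • w : EuclideanSpace ℝ (Fin d))
      (rowMatrix p)⁻¹ with ha
    have hcomb : ∑ i, a i • p i = (‖w‖ ^ 2)⁻¹ • w := by
      have : Matrix.vecMul a (rowMatrix p) = ((‖w‖ ^ 2)⁻¹ • w : EuclideanSpace ℝ (Fin d)) := by
        rw [ha, Matrix.vecMul_vecMul,
          Matrix.nonsing_inv_mul _ (isUnit_iff_ne_zero.mpr hp), Matrix.vecMul_one]
      ext j
      rw [← this]
      simp [Matrix.vecMul, dotProduct, rowMatrix]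
    have hsum : ∑ i, a i = 1 := by
      have := congrArg (fun v => inner ℝ v w) hcomb
      simp only [sum_inner, real_inner_smul_left, hin, mul_one] at this
      rw [this, real_inner_self_eq_norm_sq]
      exact inv_mul_cancel₀ (by positivity)
    rw [← hcomb, ← Finset.affineCombination_eq_linear_combination _ _ _ hsum]
    exact affineCombination_mem_affineSpan hsum p
  apply le_antisymm
  · refine (Metric.infDist_le_dist_of_mem hfoot).trans (le_of_eq ?_)
    rw [dist_zero_left, norm_smul, norm_inv, norm_pow, norm_norm]
    field_simp
  · refine (Metric.le_infDist hne).mpr fun v hv => ?_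
    rw [dist_zero_left, inv_le_iff_one_le_mul₀ hwpos]
    calc (1 : ℝ) = inner ℝ v w := (hplane v hv).symm
      _ ≤ ‖v‖ * ‖w‖ := real_inner_le_norm v w

theorem spanDist_eq_zero {p : Fin d → EuclideanSpace ℝ (Fin d)} {i : Fin d} (hi : p i = 0) :
    spanDist p = 0 :=
  Metric.infDist_zero_of_mem (hi ▸ subset_affineSpan ℝ _ (mem_range_self i))

theorem det_rowMatrix_eq_zero {p : Fin d → EuclideanSpace ℝ (Fin d)} {i : Fin d} (hi : p i = 0) :
    (rowMatrix p).det = 0 :=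
  Matrix.det_eq_zero_of_row_eq_zero i fun j => by simp [rowMatrix, hi]

end Hyperplane

/-! ### The hyperplane through Gaussian points -/

section GaussianHyperplane

variable {E : Type*} [NormedAddCommGroup E] [InnerProductSpace ℝ E] [FiniteDimensional ℝ E]
  [MeasurableSpace E] [BorelSpace E] {ι : Type*} [Fintype ι]

theorem map_toLp_pi_stdGaussian :
    (Measure.pi fun _ : ι => stdGaussian E).map (WithLp.toLp 2) =
      stdGaussian (PiLp 2 fun _ : ι => E) := by
  have : IsProbabilityMeasure ((Measure.pi fun _ : ι => stdGaussian E).map (WithLp.toLp 2)) :=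
    Measure.isProbabilityMeasure_map (by fun_prop)
  apply Measure.ext_of_charFun
  ext t
  rw [charFun_pi, charFun_stdGaussian, ← Complex.ofReal_pow, PiLp.norm_sq_eq_of_L2]
  simp only [charFun_stdGaussian]
  rw [← Complex.exp_sum]
  simp [Finset.sum_div, neg_div]

theorem map_mix_pi_stdGaussian [DecidableEq ι] {O : Matrix ι ι ℝ} (hO : O * O.transpose = 1) :
    (Measure.pi fun _ : ι => stdGaussian E).map (fun p i => ∑ j, O i j • p j) =
      Measure.pi fun _ : ι => stdGaussian E := by
  have hm : Measurable fun (p : ι → E) i => ∑ j, O i j • p j := by fun_prop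
  have : IsProbabilityMeasure ((Measure.pi fun _ : ι => stdGaussian E).map
      (fun p i => ∑ j, O i j • p j)) := Measure.isProbabilityMeasure_map hm.aemeasurable
  rw [← charFun_eq_pi_iff]
  intro t
  rw [charFun_apply, Measure.map_map (by fun_prop) hm,
    integral_map (Measurable.comp (by fun_prop) hm).aemeasurable (by fun_prop)]
  let t' : PiLp 2 fun _ : ι => E := WithLp.toLp 2 fun j => ∑ i, O i j • t i
  have h1 (p : ι → E) : inner ℝ ((WithLp.toLp 2 ∘ fun (p : ι → E) i => ∑ j, O i j • p j) p :
      PiLp 2 fun _ : ι => E) t = inner ℝ (WithLp.toLp 2 p) t' := by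
    simp only [PiLp.inner_apply, Function.comp, t', sum_inner, inner_sum, real_inner_smul_left,
      real_inner_smul_right]
    exact Finset.sum_comm
  have h2 : ‖t'‖ ^ 2 = ∑ i, ‖t i‖ ^ 2 := by
    have horth (i k : ι) : ∑ j, O i j * O k j = if i = k then 1 else 0 := by
      have := congrFun (congrFun hO i) k
      simpa [Matrix.mul_apply, Matrix.one_apply] using this
    rw [PiLp.norm_sq_eq_of_L2]
    calc ∑ j, ‖t' j‖ ^ 2 = ∑ j, ∑ i, ∑ k, (O i j * O k j) * inner ℝ (t i) (t k) := by
          refine Finset.sum_congr rfl fun j _ => ?_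
          rw [← real_inner_self_eq_norm_sq]
          simp only [t', sum_inner, inner_sum, real_inner_smul_left, real_inner_smul_right]
          exact Finset.sum_congr rfl fun i _ => Finset.sum_congr rfl fun k _ => by
            rw [real_inner_comm]; ring
      _ = ∑ i, ∑ k, (∑ j, O i j * O k j) * inner ℝ (t i) (t k) := by
          rw [Finset.sum_comm]
          refine Finset.sum_congr rfl fun i _ => ?_
          rw [Finset.sum_comm]
          exact Finset.sum_congr rfl fun k _ => by rw [Finset.sum_mul]
      _ = ∑ i, ‖t i‖ ^ 2 := by
          simp [horth]
  simp only [h1]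
  have h3 := integral_map (μ := Measure.pi fun _ : ι => stdGaussian E)
    (φ := WithLp.toLp 2) (by fun_prop)
    (f := fun w : PiLp 2 fun _ : ι => E => Complex.exp (inner ℝ w t' * Complex.I)) (by fun_prop)
  rw [← h3, map_toLp_pi_stdGaussian, ← charFun_apply, charFun_stdGaussian, ← Complex.ofReal_pow,
    h2]
  simp only [charFun_stdGaussian]
  rw [← Complex.exp_sum]
  simp [Finset.sum_div, neg_div]

theorem map_inner_stdGaussian {n : E} (hn : ‖n‖ = 1) :
    (stdGaussian E).map (fun v => inner ℝ v n) = gaussianReal 0 1 := by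
  have h := IsGaussian.map_eq_gaussianReal (μ := stdGaussian E) (innerSL ℝ n)
  rw [variance_dual_stdGaussian, integral_strongDual_stdGaussian, innerSL_apply_norm, hn] at h
  simpa [real_inner_comm] using h

variable {d : ℕ}

/-- Translating by `t • 1` preserves Lebesgue measure on matrices, and for each matrix the
determinant of the translate vanishes for finitely many `t` only. -/
theorem ae_det_rowMatrix_ne_zero_stdGaussian :
    ∀ᵐ p ∂Measure.pi (fun _ : Fin d => stdGaussian (EuclideanSpace ℝ (Fin d))),
      (rowMatrix p).det ≠ 0 := by
  let F := PiLp 2 fun _ : Fin d => EuclideanSpace ℝ (Fin d)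
  let Z : Set F := {w | (rowMatrix (WithLp.ofLp w)).det = 0}
  have hZ : MeasurableSet Z :=
    (measurable_det_rowMatrix.comp (by fun_prop)) (measurableSet_singleton 0)
  have hvol : (volume : Measure F) Z = 0 := by
    -- `u` is the identity matrix, so translates have determinants `±charpoly`
    let u : F := WithLp.toLp 2 fun i => EuclideanSpace.single i 1
    have hrow (w : F) (t : ℝ) : rowMatrix (WithLp.ofLp (w - t • u)) =
        -(Matrix.scalar (Fin d) t - rowMatrix (WithLp.ofLp w)) := by
      ext i j
      change w i j - t * (EuclideanSpace.single i (1 : ℝ) : EuclideanSpace ℝ (Fin d)) j =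
        -(Matrix.scalar (Fin d) t i j - w i j)
      by_cases hij : i = j
      · simp [hij]
      · simp [hij, Ne.symm hij]
    have hline (w : F) : volume.restrict (Icc (0 : ℝ) 1) {t | w - t • u ∈ Z} = 0 := by
      refine measure_mono_null (t := {t | ((rowMatrix (WithLp.ofLp w)).charpoly).IsRoot t}) ?_
        (Set.Finite.measure_zero
          (Polynomial.finite_setOfPred_isRoot (Matrix.charpoly_monic _).ne_zero) _)
      intro t ht
      change (rowMatrix (WithLp.ofLp (w - t • u))).det = 0 at ht
      rw [hrow, Matrix.det_neg, mul_eq_zero] at ht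
      change Polynomial.eval t _ = 0
      rw [Matrix.eval_charpoly]
      exact ht.resolve_left (pow_ne_zero _ (by norm_num))
    have hm : Measurable fun q : F × ℝ => q.1 - q.2 • u := by fun_prop
    have h1 : ((volume : Measure F).prod (volume.restrict (Icc (0 : ℝ) 1)))
        ((fun q : F × ℝ => q.1 - q.2 • u) ⁻¹' Z) = 0 := by
      rw [Measure.prod_apply (hm hZ)]
      exact (lintegral_congr fun w => hline w).trans lintegral_zero
    rw [Measure.prod_apply_symm (hm hZ)] at h1
    have h2 (t : ℝ) : (volume : Measure F) ((fun w => (w, t)) ⁻¹'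
        ((fun q : F × ℝ => q.1 - q.2 • u) ⁻¹' Z)) = volume Z := by
      have := measure_preimage_add_right (volume : Measure F) (-(t • u)) Z
      simp only [← sub_eq_add_neg] at this
      exact this
    simpa [h2] using h1
  have h0 : stdGaussian F Z = 0 := stdGaussian_absolutelyContinuous_volume hvol
  rw [← map_toLp_pi_stdGaussian, Measure.map_apply (by fun_prop) hZ] at h0
  exact measure_mono_null (fun p hp => not_not.mp hp) h0

/-- For Gaussian rows the dual vector of the first coordinate vector is `n / ⟪v, n⟫`, with `v` the
first row and `n` a unit normal to the other rows, which is independent of `v`. -/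
theorem lintegral_dualVector_single_stdGaussian {n : ℕ} {g : ℝ → ENNReal} (hg : Measurable g) :
    ∫⁻ p, g ‖dualVector p (Pi.single 0 1)‖⁻¹
        ∂Measure.pi (fun _ : Fin (n + 1) => stdGaussian (EuclideanSpace ℝ (Fin (n + 1)))) =
      ∫⁻ x, g |x| ∂gaussianReal 0 1 := by
  let E := EuclideanSpace ℝ (Fin (n + 1))
  have hmp := (measurePreserving_piFinSuccAbove
    (fun _ : Fin (n + 1) => stdGaussian E) 0).symm
  have hF : Measurable fun p : Fin (n + 1) → E => g ‖dualVector p (Pi.single 0 1)‖⁻¹ :=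
    hg.comp (measurable_dualVector _).norm.inv
  have hdet := ae_det_rowMatrix_ne_zero_stdGaussian (d := n + 1)
  rw [← hmp.map_eq] at hdet
  have hdet' := Measure.ae_ae_of_ae_prod (Measure.measurePreserving_swap.quasiMeasurePreserving.ae
    (ae_of_ae_map hmp.measurable.aemeasurable hdet))
  rw [← hmp.lintegral_comp hF, lintegral_prod_symm
    (fun q => g ‖dualVector ((MeasurableEquiv.piFinSuccAbove (fun _ => E) 0).symm q)
      (Pi.single 0 1)‖⁻¹) (hF.comp hmp.measurable).aemeasurable]
  have inner_eq : ∀ᵐ q ∂Measure.pi (fun _ : Fin n => stdGaussian E),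
      ∫⁻ v, g ‖dualVector ((MeasurableEquiv.piFinSuccAbove (fun _ => E) 0).symm (v, q))
        (Pi.single 0 1)‖⁻¹ ∂stdGaussian E = ∫⁻ x, g |x| ∂gaussianReal 0 1 := by
    filter_upwards [hdet'] with q hq
    -- the `n` rows of `q` have a common unit normal vector
    obtain ⟨m, hm1, hm⟩ : ∃ m : E, ‖m‖ = 1 ∧ ∀ j, inner ℝ (q j) m = 0 := by
      have hlt : Submodule.span ℝ (range q) < ⊤ := by
        rw [lt_top_iff_ne_top]
        intro h
        have h2 := finrank_range_le_card (R := ℝ) q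
        rw [Set.finrank, h, finrank_top] at h2
        simp [E] at h2
      have hbot : (Submodule.span ℝ (range q))ᗮ ≠ ⊥ := fun h =>
        hlt.ne ((Submodule.orthogonal_eq_bot_iff).mp h)
      obtain ⟨m, hm, hm0⟩ := Submodule.exists_mem_ne_zero_of_ne_bot hbot
      refine ⟨‖m‖⁻¹ • m, norm_smul_inv_norm (𝕜 := ℝ) hm0, fun j => ?_⟩
      rw [real_inner_smul_right, hm (q j) (Submodule.subset_span (mem_range_self j)), mul_zero]
    rw [← map_inner_stdGaussian hm1, lintegral_map (f := fun x => g |x|)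
      (hg.comp measurable_norm) (by fun_prop)]
    refine lintegral_congr_ae ?_
    filter_upwards [hq] with v hv
    set p := (MeasurableEquiv.piFinSuccAbove (fun _ => E) 0).symm (v, q) with hp
    change (rowMatrix p).det ≠ 0 at hv
    have hp0 : p 0 = v := rfl
    have hps (j : Fin n) : p j.succ = q j := rfl
    have hvm : inner ℝ v m ≠ 0 := by
      intro h
      have : m = dualVector p 0 := eq_dualVector hv fun i => by
        refine Fin.cases ?_ (fun j => ?_) i
        · rw [hp0, h, Pi.zero_apply]
        · rw [hps, hm, Pi.zero_apply]
      rw [dualVector, Matrix.mulVec_zero, WithLp.toLp_zero] at this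
      rw [this, norm_zero] at hm1
      exact zero_ne_one hm1
    have : (inner ℝ v m)⁻¹ • m = dualVector p (Pi.single 0 1) := eq_dualVector hv fun i => by
      refine Fin.cases ?_ (fun j => ?_) i
      · rw [hp0, real_inner_smul_right, Pi.single_eq_same, inv_mul_cancel₀ hvm]
      · rw [hps, real_inner_smul_right, hm, mul_zero, Pi.single_eq_of_ne (Fin.succ_ne_zero j)]
    rw [← this, norm_smul, hm1, mul_one, norm_inv, inv_inv, Real.norm_eq_abs]
  rw [lintegral_congr_ae (g := fun _ => ∫⁻ x, g |x| ∂gaussianReal 0 1) inner_eq]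
  simp

theorem exists_matrix_mulVec_eq [NeZero d] (c : Fin d → ℝ) : ∃ O : Matrix (Fin d) (Fin d) ℝ,
    O * O.transpose = 1 ∧ O.mulVec c = ‖WithLp.toLp 2 c‖ • Pi.single 0 1 := by
  obtain ⟨g, hg⟩ := exists_linearIsometryEquiv_apply_eq (u := WithLp.toLp 2 c)
    (v := ‖WithLp.toLp 2 c‖ • EuclideanSpace.single (0 : Fin d) (1 : ℝ)) (by simp [norm_smul])
  refine ⟨Matrix.of fun i j => g (EuclideanSpace.single j 1) i, ?_, ?_⟩
  · rw [mul_eq_one_comm]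
    ext j k
    have := g.inner_map_map (EuclideanSpace.single j 1) (EuclideanSpace.single k 1)
    simp only [PiLp.inner_apply, RCLike.inner_apply, conj_trivial] at this
    simp only [Matrix.mul_apply, Matrix.transpose_apply, Matrix.of_apply, Matrix.one_apply]
    simp only [mul_comm (g (EuclideanSpace.single j 1) _), this]
    simp [eq_comm]
  · have hc : WithLp.toLp 2 c = ∑ j, c j • EuclideanSpace.single j (1 : ℝ) := by
      ext i; simp [Pi.single_apply]
    ext i
    have h2 := congrArg (fun w : EuclideanSpace ℝ (Fin d) => w i) hg
    simp only at h2
    rw [hc, map_sum] at h2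
    rw [← hc] at h2
    simpa [Matrix.mulVec, dotProduct, mul_comm, Pi.single_apply] using h2

/-- For Gaussian points `σ i • p i`, `c i = 1 / σ i`, the distance of the hyperplane from the origin
is distributed as `|N| / ‖c‖` with `N` standard normal: mixing the rows by an orthogonal matrix
preserves their law and turns `c` into a multiple of the first coordinate vector. -/
theorem lintegral_dualVector_stdGaussian [NeZero d] (c : Fin d → ℝ)
    {g : ℝ → ENNReal} (hg : Measurable g) :
    ∫⁻ p, g ‖dualVector p c‖⁻¹
        ∂Measure.pi (fun _ : Fin d => stdGaussian (EuclideanSpace ℝ (Fin d))) =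
      ∫⁻ x, g (‖WithLp.toLp 2 c‖⁻¹ * |x|) ∂gaussianReal 0 1 := by
  obtain ⟨n, rfl⟩ := Nat.exists_eq_add_one_of_ne_zero (NeZero.ne d)
  obtain ⟨O, hO, hOc⟩ := exists_matrix_mulVec_eq c
  have hdet : O.det ≠ 0 := by
    intro h
    have := congrArg Matrix.det hO
    simp [h] at this
  have h1 : ∫⁻ p, g ‖dualVector p c‖⁻¹
        ∂Measure.pi (fun _ : Fin (n + 1) => stdGaussian (EuclideanSpace ℝ (Fin (n + 1)))) =
      ∫⁻ p, g ‖dualVector p (O.mulVec c)‖⁻¹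
        ∂Measure.pi (fun _ : Fin (n + 1) => stdGaussian (EuclideanSpace ℝ (Fin (n + 1)))) := by
    conv_rhs => rw [← map_mix_pi_stdGaussian hO]
    rw [lintegral_map (f := fun p => g ‖dualVector p (O.mulVec c)‖⁻¹)
      (hg.comp (measurable_dualVector _).norm.inv) (by fun_prop)]
    simp only [dualVector_mix hdet]
  rw [h1, hOc]
  simp only [dualVector_smul_right, norm_smul, norm_norm, mul_inv]
  exact lintegral_dualVector_single_stdGaussian
    (g := fun x => g (‖WithLp.toLp 2 c‖⁻¹ * x)) (by fun_prop)

end GaussianHyperplane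

/-! ### Polar coordinates for the planar Gaussian law -/

section Polar

/-- The Rayleigh law, the law of the norm of a standard Gaussian vector in the plane. -/
noncomputable def rayleighMeasure : Measure ℝ :=
  (volume.restrict (Ioi 0)).withDensity fun r => ENNReal.ofReal (r * Real.exp (-r ^ 2 / 2))

/-- The uniform law on the interval `(-π, π)`. -/
noncomputable def uniformAngle : Measure ℝ :=
  ENNReal.ofReal (2 * Real.pi)⁻¹ • volume.restrict (Ioo (-Real.pi) Real.pi)

instance : IsProbabilityMeasure uniformAngle := by
  constructor
  simp only [uniformAngle, Measure.smul_apply, Measure.restrict_apply_univ, Real.volume_Ioo,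
    smul_eq_mul]
  rw [← ENNReal.ofReal_mul (by positivity)]
  have := Real.pi_pos
  rw [show (2 * Real.pi)⁻¹ * (Real.pi - -Real.pi) = 1 by field_simp; ring, ENNReal.ofReal_one]

theorem rayleighMeasure_Ioi {x : ℝ} (hx : 0 ≤ x) :
    rayleighMeasure (Ioi x) = ENNReal.ofReal (Real.exp (-x ^ 2 / 2)) := by
  rw [rayleighMeasure, withDensity_apply _ measurableSet_Ioi, Measure.restrict_restrict
    measurableSet_Ioi, inter_eq_left.mpr (Ioi_subset_Ioi hx)]
  have hderiv (r : ℝ) (_ : r ∈ Ici x) : HasDerivAt (fun r : ℝ => -Real.exp (-r ^ 2 / 2))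
      (r * Real.exp (-r ^ 2 / 2)) r := by
    have h : HasDerivAt (fun r : ℝ => -Real.exp (-r ^ 2 / 2)) _ r :=
      (((hasDerivAt_pow 2 r).neg.div_const 2).exp).neg
    refine h.congr_deriv ?_
    simp only [Pi.neg_apply]
    push_cast
    ring
  have hlim : Filter.Tendsto (fun r : ℝ => -Real.exp (-r ^ 2 / 2)) Filter.atTop (nhds (-0)) := by
    refine (Real.tendsto_exp_atBot.comp ?_).neg
    have := (Filter.tendsto_pow_atTop (α := ℝ) two_ne_zero).atTop_div_const (r := 2) (by norm_num)
    refine (Filter.tendsto_neg_atTop_atBot.comp this).congr fun r => ?_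
    simp [neg_div]
  have hpos (r : ℝ) (hr : r ∈ Ioi x) : 0 ≤ r * Real.exp (-r ^ 2 / 2) :=
    mul_nonneg (hx.trans (le_of_lt hr)) (Real.exp_pos _).le
  rw [← ofReal_integral_eq_lintegral_ofReal
    (integrableOn_Ioi_deriv_of_nonneg' hderiv hpos hlim)
    ((ae_restrict_iff' measurableSet_Ioi).mpr (ae_of_all _ hpos)),
    integral_Ioi_of_hasDerivAt_of_nonneg' hderiv hpos hlim]
  simp

theorem rayleighMeasure_Iic_zero : rayleighMeasure (Iic 0) = 0 := by
  rw [rayleighMeasure, withDensity_apply _ measurableSet_Iic, Measure.restrict_restrict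
    measurableSet_Iic, Iic_inter_Ioi, Ioc_self, Measure.restrict_empty, lintegral_zero_measure]

theorem ae_rayleighMeasure_pos : ∀ᵐ r ∂rayleighMeasure, 0 < r :=
  ae_iff.mpr (measure_mono_null (t := Iic 0) (fun r (hr : ¬ 0 < r) => not_lt.mp hr)
    rayleighMeasure_Iic_zero)

instance : IsProbabilityMeasure rayleighMeasure := by
  constructor
  rw [← Iic_union_Ioi (a := (0 : ℝ)), measure_union (Iic_disjoint_Ioi le_rfl) measurableSet_Ioi,
    rayleighMeasure_Iic_zero, rayleighMeasure_Ioi le_rfl]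
  simp

theorem lintegral_gaussian_polar {F : ℝ × ℝ → ENNReal} (hF : Measurable F) :
    ∫⁻ q, F q ∂(gaussianReal 0 1).prod (gaussianReal 0 1) =
      ∫⁻ r, ∫⁻ θ, F (r * Real.cos θ, r * Real.sin θ) ∂uniformAngle ∂rayleighMeasure := by
  have hm : Measurable fun q : ℝ × ℝ => F (q.1 * Real.cos q.2, q.1 * Real.sin q.2) := by
    fun_prop
  have h2 : ∫⁻ r, ∫⁻ θ, F (r * Real.cos θ, r * Real.sin θ) ∂uniformAngle ∂rayleighMeasure =
      ∫⁻ q in polarCoord.target, ENNReal.ofReal (q.1 * Real.exp (-q.1 ^ 2 / 2)) *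
        (ENNReal.ofReal (2 * Real.pi)⁻¹ * F (q.1 * Real.cos q.2, q.1 * Real.sin q.2)) := by
    rw [rayleighMeasure, lintegral_withDensity_eq_lintegral_mul _ (by fun_prop)
      hm.lintegral_prod_right', polarCoord_target, Measure.volume_eq_prod, ← Measure.prod_restrict,
      lintegral_prod _ (by fun_prop)]
    refine lintegral_congr fun r => ?_
    simp only
    rw [Pi.mul_apply, uniformAngle, lintegral_smul_measure, lintegral_const_mul _ (by fun_prop),
      lintegral_const_mul _ (by fun_prop), smul_eq_mul]
  rw [h2, gaussianReal_of_var_ne_zero _ one_ne_zero, prod_withDensity (by fun_prop) (by fun_prop),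
    lintegral_withDensity_eq_lintegral_mul _ (by fun_prop) hF, ← Measure.volume_eq_prod,
    ← lintegral_comp_polarCoord_symm]
  refine setLIntegral_congr_fun polarCoord.open_target.measurableSet fun q hq => ?_
  have hq0 : 0 < q.1 := hq.1
  have key : q.1 * (gaussianPDFReal 0 1 (q.1 * Real.cos q.2) *
      gaussianPDFReal 0 1 (q.1 * Real.sin q.2)) =
      q.1 * Real.exp (-q.1 ^ 2 / 2) * (2 * Real.pi)⁻¹ := by
    simp only [gaussianPDFReal, NNReal.coe_one, mul_one, sub_zero]
    rw [mul_mul_mul_comm, ← Real.exp_add, ← mul_inv, Real.mul_self_sqrt (by positivity),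
      mul_assoc, mul_comm (Real.exp _)]
    congr 3
    have := Real.sin_sq_add_cos_sq q.2
    linear_combination -(q.1 ^ 2 / 2) * this
  simp only [polarCoord_symm_apply, Pi.mul_apply, smul_eq_mul, gaussianPDF]
  rw [← ENNReal.ofReal_mul (gaussianPDFReal_nonneg _ _ _), ← mul_assoc,
    ← ENNReal.ofReal_mul hq0.le, key, ENNReal.ofReal_mul (by positivity), mul_assoc]

theorem lintegral_abs_gaussianReal {g : ℝ → ENNReal} (hg : Measurable g) :
    ∫⁻ x, g |x| ∂gaussianReal 0 1 =
      ∫⁻ r, ∫⁻ θ, g (r * |Real.cos θ|) ∂uniformAngle ∂rayleighMeasure := by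
  have h := lintegral_gaussian_polar (F := fun q => g |q.1|) (by fun_prop)
  rw [lintegral_prod _ (by fun_prop)] at h
  simp only [lintegral_const, measure_univ, mul_one] at h
  rw [h]
  refine lintegral_congr_ae ?_
  filter_upwards [ae_rayleighMeasure_pos] with r hr
  simp [abs_mul, abs_of_pos hr]

theorem prod_gaussianReal_norm_gt {x : ℝ} (hx : 0 ≤ x) :
    (gaussianReal 0 1).prod (gaussianReal 0 1) {q : ℝ × ℝ | x < √(q.1 ^ 2 + q.2 ^ 2)} =
      ENNReal.ofReal (Real.exp (-x ^ 2 / 2)) := by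
  have hm : MeasurableSet {q : ℝ × ℝ | x < √(q.1 ^ 2 + q.2 ^ 2)} :=
    measurableSet_lt (by fun_prop) (by fun_prop)
  rw [← lintegral_indicator_one hm, lintegral_gaussian_polar (measurable_one.indicator hm),
    ← rayleighMeasure_Ioi hx, ← lintegral_indicator_one measurableSet_Ioi]
  refine lintegral_congr_ae ?_
  filter_upwards [ae_rayleighMeasure_pos] with r hr
  have (θ : ℝ) : √((r * Real.cos θ) ^ 2 + (r * Real.sin θ) ^ 2) = r := by
    rw [mul_pow, mul_pow, ← mul_add, Real.cos_sq_add_sin_sq, mul_one,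
      Real.sqrt_sq hr.le]
  simp [indicator, this]

theorem uniformAngle_abs_cos_ge {t : ℝ} (ht : 0 ≤ t) (ht1 : t ≤ 1) :
    uniformAngle {θ | t ≤ |Real.cos θ|} = ENNReal.ofReal (2 / Real.pi * Real.arccos t) := by
  have hpi := Real.pi_pos
  have ha0 := Real.arccos_nonneg t
  have ha1 : Real.arccos t ≤ Real.pi / 2 := Real.arccos_le_pi_div_two.mpr ht
  have hcos := Real.cos_arccos (by linarith) ht1
  set a := Real.arccos t with ha
  have hm : MeasurableSet {θ | t ≤ |Real.cos θ|} := measurableSet_le (by fun_prop) (by fun_prop)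
  have hpos (θ : ℝ) (h0 : 0 ≤ θ) (h1 : θ ≤ Real.pi) :
      |Real.cos θ| < t ↔ θ ∈ Ioo a (Real.pi - a) := by
    rw [abs_lt, mem_Ioo, ← hcos, ← Real.cos_pi_sub,
      Real.strictAntiOn_cos.lt_iff_gt ⟨by linarith, by linarith⟩ ⟨h0, h1⟩,
      Real.strictAntiOn_cos.lt_iff_gt ⟨h0, h1⟩ ⟨ha0, by linarith⟩, and_comm]
  -- the complement consists of two intervals, around `π / 2` and `-π / 2`
  have hcompl : Ioo (-Real.pi) Real.pi ∩ {θ | t ≤ |Real.cos θ|}ᶜ =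
      Ioo a (Real.pi - a) ∪ Ioo (-(Real.pi - a)) (-a) := by
    ext θ
    simp only [mem_inter_iff, mem_compl_iff, mem_ofPred_eq, not_le, mem_union]
    constructor
    · rintro ⟨⟨h1, h2⟩, h3⟩
      rcases le_total 0 θ with h | h
      · exact Or.inl ((hpos θ h h2.le).mp h3)
      · have := (hpos (-θ) (by linarith) (by linarith)).mp (by rwa [Real.cos_neg])
        exact Or.inr ⟨by linarith [this.2], by linarith [this.1]⟩
    · rintro (h | h)
      · refine ⟨⟨by linarith [h.1], by linarith [h.2]⟩, ?_⟩
        exact (hpos θ (by linarith [h.1]) (by linarith [h.2])).mpr h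
      · refine ⟨⟨by linarith [h.1], by linarith [h.2]⟩, ?_⟩
        rw [← Real.cos_neg]
        exact (hpos (-θ) (by linarith [h.2]) (by linarith [h.1])).mpr
          ⟨by linarith [h.2], by linarith [h.1]⟩
  have hc : uniformAngle {θ | t ≤ |Real.cos θ|}ᶜ =
      ENNReal.ofReal (1 - 2 / Real.pi * a) := by
    rw [uniformAngle, Measure.smul_apply, Measure.restrict_apply hm.compl, inter_comm, hcompl,
      measure_union _ measurableSet_Ioo, Real.volume_Ioo, Real.volume_Ioo, smul_eq_mul,
      ← ENNReal.ofReal_add (by linarith) (by linarith), ← ENNReal.ofReal_mul (by positivity)]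
    · congr 1
      field_simp
      ring
    · rw [Set.disjoint_left]
      intro θ h1 h2
      linarith [h1.1, h2.2]
  have hle : 2 / Real.pi * a ≤ 1 := by
    rw [div_mul_eq_mul_div, div_le_one hpi]; linarith
  rw [← compl_compl {θ | t ≤ |Real.cos θ|}, prob_compl_eq_one_sub hm.compl, hc,
    ← ENNReal.ofReal_one, ← ENNReal.ofReal_sub _ (by linarith)]
  congr 1
  ring

end Polar

/-! ### Planar radii -/

section PlanarRadius

variable {d : ℕ}

/-- The norm of the projection to the plane of the first two coordinates. -/
noncomputable def planarRadius (hd : 2 ≤ d) (v : EuclideanSpace ℝ (Fin d)) : ℝ :=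
  √(v ⟨0, by omega⟩ ^ 2 + v ⟨1, by omega⟩ ^ 2)

theorem univ_fin_nonempty (hd : 2 ≤ d) : (Finset.univ : Finset (Fin d)).Nonempty :=
  ⟨⟨0, by omega⟩, Finset.mem_univ _⟩

/-- The smallest planar radius of `d` points. -/
noncomputable def minPlanarRadius (hd : 2 ≤ d) (p : Fin d → EuclideanSpace ℝ (Fin d)) : ℝ :=
  Finset.univ.inf' (univ_fin_nonempty hd) fun i => planarRadius hd (p i)

@[fun_prop]
theorem measurable_planarRadius (hd : 2 ≤ d) : Measurable (planarRadius hd) := by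
  unfold planarRadius; fun_prop

theorem planarRadius_nonneg (hd : 2 ≤ d) (v : EuclideanSpace ℝ (Fin d)) :
    0 ≤ planarRadius hd v := Real.sqrt_nonneg _

theorem planarRadius_smul (hd : 2 ≤ d) {s : ℝ} (hs : 0 ≤ s) (v : EuclideanSpace ℝ (Fin d)) :
    planarRadius hd (s • v) = s * planarRadius hd v := by
  simp only [planarRadius, PiLp.smul_apply, smul_eq_mul, mul_pow]
  rw [← mul_add, Real.sqrt_mul (by positivity), Real.sqrt_sq hs]

@[fun_prop]
theorem measurable_minPlanarRadius (hd : 2 ≤ d) : Measurable (minPlanarRadius hd) := by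
  refine Continuous.measurable (Continuous.finset_inf'_apply _ fun i _ => ?_)
  unfold planarRadius
  fun_prop

theorem minPlanarRadius_nonneg (hd : 2 ≤ d) (p : Fin d → EuclideanSpace ℝ (Fin d)) :
    0 ≤ minPlanarRadius hd p :=
  (Finset.le_inf'_iff _ _).mpr fun _ _ => planarRadius_nonneg hd _

theorem lt_minPlanarRadius_iff (hd : 2 ≤ d) {y : ℝ} {p : Fin d → EuclideanSpace ℝ (Fin d)} :
    y < minPlanarRadius hd p ↔ ∀ i, y < planarRadius hd (p i) := by
  rw [minPlanarRadius, Finset.lt_inf'_iff]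
  simp

theorem stdGaussian_planarRadius_gt (hd : 2 ≤ d) {x : ℝ} (hx : 0 ≤ x) :
    stdGaussian (EuclideanSpace ℝ (Fin d)) {v | x < planarRadius hd v} =
      ENNReal.ofReal (Real.exp (-x ^ 2 / 2)) := by
  let i0 : Fin d := ⟨0, by omega⟩
  let i1 : Fin d := ⟨1, by omega⟩
  have hne : i0 ≠ i1 := by simp [i0, i1]
  have hpair : (Measure.pi fun _ : Fin d => gaussianReal 0 1).map (fun w => (w i0, w i1)) =
      (gaussianReal 0 1).prod (gaussianReal 0 1) := by
    have h := (iIndepFun_pi (μ := fun _ : Fin d => gaussianReal 0 1) (X := fun _ x => x)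
      fun _ => aemeasurable_id).indepFun hne
    rw [indepFun_iff_map_prod_eq_prod_map_map (measurable_pi_apply i0).aemeasurable
      (measurable_pi_apply i1).aemeasurable] at h
    rw [h]
    congr 1
    · exact (measurePreserving_eval (fun _ : Fin d => gaussianReal 0 1) i0).map_eq
    · exact (measurePreserving_eval (fun _ : Fin d => gaussianReal 0 1) i1).map_eq
  have hm : MeasurableSet {q : ℝ × ℝ | x < √(q.1 ^ 2 + q.2 ^ 2)} :=
    measurableSet_lt (by fun_prop) (by fun_prop)
  rw [← prod_gaussianReal_norm_gt hx, ← hpair, Measure.map_apply (by fun_prop) hm,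
    ← map_pi_eq_stdGaussian, Measure.map_apply (by fun_prop)
      (measurableSet_lt (by fun_prop) (by fun_prop))]
  rfl

theorem measure_pi_minPlanarRadius_gt (hd : 2 ≤ d)
    {ν : Fin d → Measure (EuclideanSpace ℝ (Fin d))} [∀ i, SigmaFinite (ν i)] (y : ℝ) :
    Measure.pi ν {p | y < minPlanarRadius hd p} = ∏ i, ν i {v | y < planarRadius hd v} := by
  rw [← Measure.pi_pi]
  congr 1
  ext p
  simp [lt_minPlanarRadius_iff]

/-- The smallest planar radius of independent Gaussian points `σ i • p i` has a Rayleigh law with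
parameter determined by `∑ i, (σ i)⁻²`. -/
theorem lintegral_minPlanarRadius_stdGaussian (hd : 2 ≤ d) {σ : Fin d → ℝ} (hσ : ∀ i, 0 < σ i)
    {g : ℝ → ENNReal} (hg : Measurable g) :
    ∫⁻ p, g (minPlanarRadius hd fun i => σ i • p i)
        ∂Measure.pi (fun _ : Fin d => stdGaussian (EuclideanSpace ℝ (Fin d))) =
      ∫⁻ r, g (‖WithLp.toLp 2 fun i => (σ i)⁻¹‖⁻¹ * r) ∂rayleighMeasure := by
  set Γ := Measure.pi (fun _ : Fin d => stdGaussian (EuclideanSpace ℝ (Fin d)))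
  set b := ‖(WithLp.toLp 2 fun i => (σ i)⁻¹ : EuclideanSpace ℝ (Fin d))‖ with hb
  have hbsq : b ^ 2 = ∑ i, (σ i)⁻¹ ^ 2 := by
    rw [hb, EuclideanSpace.real_norm_sq_eq]
  have hbpos : 0 < b := by
    rw [hb, norm_pos_iff]
    intro h
    have := congrArg (fun w : EuclideanSpace ℝ (Fin d) => w ⟨0, by omega⟩) h
    exact (inv_pos.mpr (hσ ⟨0, by omega⟩)).ne' this
  have hm : Measurable fun p : Fin d → EuclideanSpace ℝ (Fin d) =>
      minPlanarRadius hd fun i => σ i • p i :=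
    (measurable_minPlanarRadius hd).comp (by fun_prop)
  have : IsProbabilityMeasure (Γ.map fun p => minPlanarRadius hd fun i => σ i • p i) :=
    Measure.isProbabilityMeasure_map hm.aemeasurable
  have : IsProbabilityMeasure (rayleighMeasure.map fun r => b⁻¹ * r) :=
    Measure.isProbabilityMeasure_map (by fun_prop)
  have hlaw : Γ.map (fun p => minPlanarRadius hd fun i => σ i • p i) =
      rayleighMeasure.map fun r => b⁻¹ * r := by
    refine Measure.ext_of_Iic _ _ fun y => ?_
    rcases lt_or_ge y 0 with hy | hy
    · rw [Measure.map_apply hm measurableSet_Iic, Measure.map_apply (by fun_prop)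
        measurableSet_Iic]
      have h1 : (fun p : Fin d → EuclideanSpace ℝ (Fin d) =>
          minPlanarRadius hd fun i => σ i • p i) ⁻¹' Iic y = ∅ := by
        ext p
        simp only [mem_preimage, mem_Iic, mem_empty_iff_false, iff_false, not_le]
        exact hy.trans_le (minPlanarRadius_nonneg hd _)
      have h2 : (fun r : ℝ => b⁻¹ * r) ⁻¹' Iic y ⊆ Iic 0 := by
        intro r hr
        by_contra hr0
        have : 0 < b⁻¹ * r := mul_pos (inv_pos.mpr hbpos) (not_le.mp hr0)
        exact absurd (hr.trans_lt hy) (not_lt.mpr this.le)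
      rw [h1, measure_empty, measure_mono_null h2 rayleighMeasure_Iic_zero]
    · rw [← compl_Ioi, prob_compl_eq_one_sub measurableSet_Ioi,
        prob_compl_eq_one_sub measurableSet_Ioi, Measure.map_apply hm measurableSet_Ioi,
        Measure.map_apply (by fun_prop) measurableSet_Ioi]
      congr 1
      have h1 : (fun r : ℝ => b⁻¹ * r) ⁻¹' Ioi y = Ioi (b * y) := by
        ext r
        simp only [mem_preimage, mem_Ioi]
        rw [inv_mul_eq_div, lt_div_iff₀ hbpos, mul_comm]
      have h2 : (fun p : Fin d → EuclideanSpace ℝ (Fin d) =>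
          minPlanarRadius hd fun i => σ i • p i) ⁻¹' Ioi y =
          univ.pi fun i => {v | (σ i)⁻¹ * y < planarRadius hd v} := by
        ext p
        simp only [mem_preimage, mem_Ioi, lt_minPlanarRadius_iff, mem_univ_pi, mem_ofPred_eq]
        refine forall_congr' fun i => ?_
        rw [planarRadius_smul hd (hσ i).le, inv_mul_eq_div, div_lt_iff₀ (hσ i), mul_comm]
      rw [h1, h2, Measure.pi_pi, rayleighMeasure_Ioi (by positivity)]
      have h3 (i : Fin d) := stdGaussian_planarRadius_gt hd (x := (σ i)⁻¹ * y)
        (mul_nonneg (inv_pos.mpr (hσ i)).le hy)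
      simp only [h3]
      rw [← ENNReal.ofReal_prod_of_nonneg fun i _ => (Real.exp_pos _).le, ← Real.exp_sum]
      congr 2
      rw [mul_pow, hbsq, Finset.sum_mul, ← Finset.sum_neg_distrib, Finset.sum_div]
      exact Finset.sum_congr rfl fun i _ => by rw [mul_pow]
  rw [← lintegral_map (f := g) hg hm, hlaw, lintegral_map hg (by fun_prop)]

end PlanarRadius

/-! ### Projection of isotropic laws to the plane -/

section PlanarProjection

variable {d : ℕ}

/-- `planarKernel d x r` is, for `0 ≤ x`, the probability that the projection to a plane of a
uniformly distributed point of the sphere of radius `r` in `ℝ^d` has norm greater than `x`. -/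
noncomputable def planarKernel (d : ℕ) (x r : ℝ) : ENNReal :=
  (Ioi x).indicator (fun r => ENNReal.ofReal (lambdaFun d (x / r))) r

theorem continuous_lambdaFun (hd : 2 ≤ d) : Continuous (lambdaFun d) := by
  have : (2 : ℝ) ≤ d := by exact_mod_cast hd
  exact Continuous.rpow_const (by fun_prop) fun _ => Or.inr (by linarith)

@[fun_prop]
theorem measurable_lambdaFun : Measurable (lambdaFun d) := by
  unfold lambdaFun; fun_prop

theorem div_mem_Icc {x r : ℝ} (hx : 0 ≤ x) (hr : x < r) : x / r ∈ Icc (0 : ℝ) 1 :=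
  ⟨div_nonneg hx (hx.trans hr.le), div_le_one_of_le₀ hr.le (hx.trans hr.le)⟩

theorem lambdaFun_nonneg {t : ℝ} (ht : t ∈ Icc (0 : ℝ) 1) : 0 ≤ lambdaFun d t :=
  Real.rpow_nonneg (by nlinarith [ht.1, ht.2]) _

theorem lambdaFun_le_one (hd : 2 ≤ d) {t : ℝ} (ht : t ∈ Icc (0 : ℝ) 1) : lambdaFun d t ≤ 1 := by
  have : (2 : ℝ) ≤ d := by exact_mod_cast hd
  exact Real.rpow_le_one (by nlinarith [ht.1, ht.2]) (by nlinarith [ht.1]) (by linarith)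

@[fun_prop]
theorem measurable_planarKernel (x : ℝ) : Measurable (planarKernel d x) :=
  Measurable.indicator (by fun_prop) measurableSet_Ioi

theorem planarKernel_le_one (hd : 2 ≤ d) {x : ℝ} (hx : 0 ≤ x) (r : ℝ) :
    planarKernel d x r ≤ 1 := by
  refine indicator_apply_le' (fun hr => ?_) fun _ => zero_le_one
  exact ENNReal.ofReal_le_one.mpr (lambdaFun_le_one hd (div_mem_Icc hx hr))

theorem planarKernel_mul {b : ℝ} (hb : 0 < b) (x r : ℝ) :
    planarKernel d x (b * r) = planarKernel d (x / b) r := by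
  have h : x < b * r ↔ x / b < r := by rw [div_lt_iff₀ hb, mul_comm]
  simp only [planarKernel, indicator, mem_Ioi, h, div_div]

theorem image_sqrt_add_sq {x : ℝ} (hx : 0 ≤ x) :
    (fun s : ℝ => √(s ^ 2 + x ^ 2)) '' Ioi 0 = Ioi x := by
  ext r
  simp only [mem_image, mem_Ioi]
  constructor
  · rintro ⟨s, hs, rfl⟩
    exact Real.lt_sqrt_of_sq_lt (by nlinarith)
  · intro hr
    have h : 0 < r ^ 2 - x ^ 2 := by nlinarith
    refine ⟨√(r ^ 2 - x ^ 2), Real.sqrt_pos.mpr h, ?_⟩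
    rw [Real.sq_sqrt h.le, sub_add_cancel, Real.sqrt_sq (hx.trans hr.le)]

/-- The substitution `r = √(s² + x²)`. -/
theorem integral_pow_mul_lambdaFun (hd : 2 ≤ d) {x : ℝ} (hx : 0 ≤ x) :
    ∫ r in Ioi x, r ^ (d - 1) * (Real.exp (-(1 / 2) * r ^ 2) * lambdaFun d (x / r)) =
      Real.exp (-x ^ 2 / 2) * ∫ s in Ioi (0 : ℝ), s ^ (d - 1) * Real.exp (-(1 / 2) * s ^ 2) := by
  have hpos (s : ℝ) (hs : s ∈ Ioi (0 : ℝ)) : 0 < s ^ 2 + x ^ 2 := by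
    have : 0 < s ^ 2 := pow_pos hs 2
    positivity
  have hder (s : ℝ) (hs : s ∈ Ioi (0 : ℝ)) : HasDerivWithinAt (fun s : ℝ => √(s ^ 2 + x ^ 2))
      (s / √(s ^ 2 + x ^ 2)) (Ioi 0) s := by
    have h := (((hasDerivAt_pow 2 s).add_const (x ^ 2)).sqrt (hpos s hs).ne').hasDerivWithinAt
      (s := Ioi 0)
    refine h.congr_deriv ?_
    have := Real.sqrt_pos.mpr (hpos s hs)
    field_simp
    ring
  have hinj : InjOn (fun s : ℝ => √(s ^ 2 + x ^ 2)) (Ioi 0) := by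
    intro a ha b hb h
    have h2 := congrArg (· ^ 2) h
    simp only at h2
    rw [Real.sq_sqrt (hpos a ha).le, Real.sq_sqrt (hpos b hb).le] at h2
    exact (pow_left_inj₀ (le_of_lt ha) (le_of_lt hb) two_ne_zero).mp (by linarith)
  rw [← image_sqrt_add_sq hx, integral_image_eq_integral_abs_deriv_smul measurableSet_Ioi hder
    hinj, ← integral_const_mul]
  refine setIntegral_congr_fun measurableSet_Ioi fun s hs => ?_
  simp only [smul_eq_mul]
  set φ := √(s ^ 2 + x ^ 2) with hφ
  have hs0 : 0 < s := hs
  have hφ0 : 0 < φ := Real.sqrt_pos.mpr (hpos s hs)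
  have hφ2 : φ ^ 2 = s ^ 2 + x ^ 2 := Real.sq_sqrt (hpos s hs).le
  have hlam : lambdaFun d (x / φ) = (s / φ) ^ (d - 2) := by
    have h1 : 1 - (x / φ) ^ 2 = (s / φ) ^ 2 := by
      field_simp
      linarith
    rw [lambdaFun, h1, ← Real.rpow_natCast, ← Real.rpow_mul (by positivity),
      ← Real.rpow_natCast, Nat.cast_sub hd]
    congr 1
    push_cast
    ring
  obtain ⟨n, rfl⟩ := Nat.exists_eq_add_of_le hd
  have e1 : 2 + n - 1 = n + 1 := by omega
  have e2 : 2 + n - 2 = n := by omega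
  have e3 : Real.exp (-(1 / 2) * φ ^ 2) =
      Real.exp (-x ^ 2 / 2) * Real.exp (-(1 / 2) * s ^ 2) := by
    rw [← Real.exp_add, hφ2]
    congr 1
    ring
  rw [hlam, e1, e2, e3, abs_of_pos (by positivity), div_pow]
  field_simp
  ring

theorem lintegral_planarKernel_stdGaussian (hd : 2 ≤ d) {x : ℝ} (hx : 0 ≤ x) :
    ∫⁻ v, planarKernel d x ‖v‖ ∂stdGaussian (EuclideanSpace ℝ (Fin d)) =
      ENNReal.ofReal (Real.exp (-x ^ 2 / 2)) := by
  have : Nontrivial (EuclideanSpace ℝ (Fin d)) := by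
    have : Nontrivial (Fin d) := Fin.nontrivial_iff_two_le.mpr hd
    exact Module.nontrivial_of_finrank_pos (R := ℝ) (by rw [finrank_euclideanSpace_fin]; omega)
  have hfin : Module.finrank ℝ (EuclideanSpace ℝ (Fin d)) = d := by simp
  let c : ℝ := (2 * Real.pi / 1) ^ (-((Module.finrank ℝ (EuclideanSpace ℝ (Fin d)) : ℝ) / 2))
  have hdens (v : EuclideanSpace ℝ (Fin d)) : 
      gaussianDensity (EuclideanSpace ℝ (Fin d)) 1 v = c * Real.exp (-(1 / 2) * ‖v‖ ^ 2) := rfl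
  let f (r : ℝ) : ℝ := (Ioi x).indicator (fun r => lambdaFun d (x / r)) r
  have hf0 (r : ℝ) : 0 ≤ f r :=
    indicator_nonneg (fun r hr => lambdaFun_nonneg (div_mem_Icc hx hr)) r
  have hf1 (r : ℝ) : f r ≤ 1 :=
    indicator_apply_le' (fun hr => lambdaFun_le_one hd (div_mem_Icc hx hr)) fun _ => zero_le_one
  have hfm : Measurable f := Measurable.indicator (by fun_prop) measurableSet_Ioi
  have hkf (r : ℝ) : planarKernel d x r = ENNReal.ofReal (f r) := by
    simp only [planarKernel, f, indicator]
    split_ifs <;> simp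
  simp only [hkf]
  rw [← ofReal_integral_eq_lintegral_ofReal ?_ (ae_of_all _ fun v => hf0 _)]
  swap
  · refine Integrable.of_bound (C := 1) (hfm.comp measurable_norm).aestronglyMeasurable
      (ae_of_all _ fun v => ?_)
    rw [Real.norm_of_nonneg (hf0 _)]
    exact hf1 _
  congr 1
  -- the total mass of the Gaussian law in polar coordinates
  have hnorm : Module.finrank ℝ (EuclideanSpace ℝ (Fin d)) •
      (volume : Measure (EuclideanSpace ℝ (Fin d))).real (Metric.ball 0 1) •
      (c * ∫ s in Ioi (0 : ℝ), s ^ (d - 1) * Real.exp (-(1 / 2) * s ^ 2)) = 1 := by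
    have h := integral_gaussianDensity (E := EuclideanSpace ℝ (Fin d)) one_pos
    simp only [hdens] at h
    rw [integral_fun_norm_addHaar (volume : Measure (EuclideanSpace ℝ (Fin d)))
      (fun r => c * Real.exp (-(1 / 2) * r ^ 2)), hfin] at h
    refine Eq.trans ?_ h
    rw [hfin, ← integral_const_mul]
    simp only [smul_eq_mul, mul_left_comm c]
  rw [stdGaussian_eq_withDensity, integral_withDensity_eq_integral_toReal_smul (by fun_prop)
    (by simp)]
  simp only [ENNReal.toReal_ofReal (gaussianDensity_pos one_pos _).le]
  simp only [hdens, smul_eq_mul]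
  rw [integral_fun_norm_addHaar (volume : Measure (EuclideanSpace ℝ (Fin d)))
      (fun r => c * Real.exp (-(1 / 2) * r ^ 2) * f r)]
  have hI : ∫ r in Ioi (0 : ℝ), r ^ (Module.finrank ℝ (EuclideanSpace ℝ (Fin d)) - 1) •
      (c * Real.exp (-(1 / 2) * r ^ 2) * f r) = Real.exp (-x ^ 2 / 2) *
        (c * ∫ s in Ioi (0 : ℝ), s ^ (d - 1) * Real.exp (-(1 / 2) * s ^ 2)) := by
    have h1 (r : ℝ) : r ^ (Module.finrank ℝ (EuclideanSpace ℝ (Fin d)) - 1) •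
        (c * Real.exp (-(1 / 2) * r ^ 2) * f r) =
        (Ioi x).indicator (fun r => c * (r ^ (d - 1) * (Real.exp (-(1 / 2) * r ^ 2) *
          lambdaFun d (x / r)))) r := by
      simp only [f, indicator, hfin, smul_eq_mul]
      split_ifs
      · ring
      · simp
    simp only [h1]
    rw [setIntegral_indicator measurableSet_Ioi, inter_eq_right.mpr (Ioi_subset_Ioi hx),
      integral_const_mul, integral_pow_mul_lambdaFun hd hx]
    ring
  rw [hI]
  calc _ = Real.exp (-x ^ 2 / 2) * (Module.finrank ℝ (EuclideanSpace ℝ (Fin d)) •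
        (volume : Measure (EuclideanSpace ℝ (Fin d))).real (Metric.ball 0 1) •
        (c * ∫ s in Ioi (0 : ℝ), s ^ (d - 1) * Real.exp (-(1 / 2) * s ^ 2))) := by
        simp only [smul_eq_mul, nsmul_eq_mul]
        ring
    _ = _ := by rw [hnorm, mul_one]

theorem tendsto_planarKernel (hd : 2 ≤ d) (x r : ℝ) :
    Filter.Tendsto (fun z => planarKernel d z r) (nhdsWithin x (Ioi x))
      (nhds (planarKernel d x r)) := by
  rcases lt_or_ge x r with h | h
  · have h1 : ∀ᶠ z in nhdsWithin x (Ioi x), ENNReal.ofReal (lambdaFun d (z / r)) =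
        planarKernel d z r := by
      filter_upwards [nhdsWithin_le_nhds (eventually_lt_nhds h)] with z hz
      rw [planarKernel, indicator_of_mem (mem_Ioi.mpr hz)]
    rw [planarKernel, indicator_of_mem (mem_Ioi.mpr h)]
    refine Filter.Tendsto.congr' h1 ?_
    have hc : Continuous fun z => ENNReal.ofReal (lambdaFun d (z / r)) :=
      ENNReal.continuous_ofReal.comp
        ((continuous_lambdaFun hd).comp (continuous_id.div_const r))
    exact hc.continuousWithinAt
  · rw [planarKernel, indicator_of_notMem (by simpa using h)]
    refine tendsto_const_nhds.congr' ?_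
    filter_upwards [self_mem_nhdsWithin] with z hz
    rw [planarKernel, indicator_of_notMem (by simpa using h.trans (le_of_lt hz))]

theorem tendsto_indicator_Ioi (x r : ℝ) :
    Filter.Tendsto (fun z => (Ioi z).indicator (1 : ℝ → ENNReal) r) (nhdsWithin x (Ioi x))
      (nhds ((Ioi x).indicator 1 r)) := by
  refine tendsto_const_nhds.congr' ?_
  rcases lt_or_ge x r with h | h
  · filter_upwards [nhdsWithin_le_nhds (eventually_lt_nhds h)] with z hz
    rw [indicator_of_mem (mem_Ioi.mpr h), indicator_of_mem (mem_Ioi.mpr hz)]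
  · filter_upwards [self_mem_nhdsWithin] with z hz
    rw [indicator_of_notMem (by simpa using h),
      indicator_of_notMem (by simpa using h.trans (le_of_lt hz))]

/-- The exchange of radii reduces the claim, averaged over a Gaussian rescaling, to Gaussian laws.
Laplace inversion gives the claim for almost every `x`, and both sides are right continuous. -/
theorem measure_planarRadius_gt (hd : 2 ≤ d) {μ : Measure (EuclideanSpace ℝ (Fin d))}
    [IsProbabilityMeasure μ] (hμ : IsSphericallySymmetric μ) {x : ℝ} (hx : 0 ≤ x) :
    μ {v | x < planarRadius hd v} = ∫⁻ v, planarKernel d x ‖v‖ ∂μ := by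
  let γ := stdGaussian (EuclideanSpace ℝ (Fin d))
  have : Nontrivial (EuclideanSpace ℝ (Fin d)) := by
    have : Nontrivial (Fin d) := Fin.nontrivial_iff_two_le.mpr hd
    exact Module.nontrivial_of_finrank_pos (R := ℝ) (by rw [finrank_euclideanSpace_fin]; omega)
  let k (z r : ℝ) : ENNReal := (Ioi z).indicator 1 r
  have hk (z : ℝ) : Measurable (k z) := measurable_one.indicator measurableSet_Ioi
  have hk1 (z r : ℝ) : k z r ≤ 1 := indicator_apply_le' (fun _ => le_rfl) fun _ => zero_le_one
  have hkmul {b : ℝ} (hb : 0 < b) (z r : ℝ) : k z (b * r) = k (z / b) r := by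
    have h : z < b * r ↔ z / b < r := by rw [div_lt_iff₀ hb, mul_comm]
    simp only [k, indicator, mem_Ioi, h, Pi.one_apply]
  have hset (ν : Measure (EuclideanSpace ℝ (Fin d))) (z : ℝ) :
      ν {v | z < planarRadius hd v} = ∫⁻ v, k z (planarRadius hd v) ∂ν := by
    rw [← lintegral_indicator_one (measurableSet_lt (by fun_prop) (by fun_prop))]
    rfl
  rw [hset]
  have hgauss {b : ℝ} (hb : 0 < b) : ∫⁻ y, k 1 (b * planarRadius hd y) ∂γ =
      ∫⁻ y, planarKernel d 1 (b * ‖y‖) ∂γ := by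
    simp only [hkmul hb, planarKernel_mul hb]
    rw [← hset, stdGaussian_planarRadius_gt hd (by positivity),
      lintegral_planarKernel_stdGaussian hd (by positivity)]
  -- by homogeneity the scale `‖y‖` at threshold `1` stands for the threshold `1 / ‖y‖`
  have hae : ∀ᵐ y ∂γ, ∫⁻ v, k 1 (‖y‖ * planarRadius hd v) ∂μ =
      ∫⁻ v, planarKernel d 1 (‖y‖ * ‖v‖) ∂μ := by
    have hev := measurePreserving_eval (fun _ : Unit => γ) ()
    have hevμ := measurePreserving_eval (fun _ : Unit => μ) ()
    have key (F : EuclideanSpace ℝ (Fin d) → ENNReal) (hF : Measurable F) :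
        ∫⁻ y, ∫⁻ v, F (‖y ()‖ • v) ∂μ ∂Measure.pi (fun _ : Unit => γ) =
          ∫⁻ p, ∫⁻ y, F (‖p ()‖ • y) ∂γ ∂Measure.pi (fun _ : Unit => μ) := by
      have h := lintegral_norm_smul_swap (μ := μ) (ν := γ) hμ stdGaussian_map_linearIsometryEquiv
        (ι := Unit) (F := fun z => F (z ())) (by fun_prop)
      have e1 (y : Unit → EuclideanSpace ℝ (Fin d)) :
          ∫⁻ p : Unit → EuclideanSpace ℝ (Fin d), F (‖y ()‖ • p ())
            ∂Measure.pi (fun _ => μ) =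
          ∫⁻ v, F (‖y ()‖ • v) ∂μ :=
        hevμ.lintegral_comp (f := fun v => F (‖y ()‖ • v)) (by fun_prop)
      have e2 (p : Unit → EuclideanSpace ℝ (Fin d)) :
          ∫⁻ y : Unit → EuclideanSpace ℝ (Fin d), F (‖p ()‖ • y ())
            ∂Measure.pi (fun _ => γ) =
          ∫⁻ v, F (‖p ()‖ • v) ∂γ :=
        hev.lintegral_comp (f := fun v => F (‖p ()‖ • v)) (by fun_prop)
      simpa only [e1, e2] using h
    have h := ae_eq_of_lintegral_norm_stdGaussian (E := EuclideanSpace ℝ (Fin d))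
      (ι := Unit) (C := 1)
      (h₁ := fun s => ∫⁻ v, k 1 (s () * planarRadius hd v) ∂μ)
      (h₂ := fun s => ∫⁻ v, planarKernel d 1 (s () * ‖v‖) ∂μ)
      (Measurable.lintegral_prod_right'
        (f := fun q : (Unit → ℝ) × EuclideanSpace ℝ (Fin d) =>
          k 1 (q.1 () * planarRadius hd q.2)) (by fun_prop))
      (Measurable.lintegral_prod_right'
        (f := fun q : (Unit → ℝ) × EuclideanSpace ℝ (Fin d) =>
          planarKernel d 1 (q.1 () * ‖q.2‖)) (by fun_prop))
      ENNReal.one_ne_top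
      (fun s => (lintegral_mono fun v => hk1 _ _).trans (by simp))
      (fun s => (lintegral_mono fun v => planarKernel_le_one hd zero_le_one _).trans (by simp))
      (fun a ha => by
        have h1 := key (fun z => k 1 (a () * planarRadius hd z)) (by fun_prop)
        have h2 := key (fun z => planarKernel d 1 (a () * ‖z‖)) (by fun_prop)
        simp only [planarRadius_smul hd (norm_nonneg _), norm_smul, norm_norm, ← mul_assoc]
          at h1 h2
        change ∫⁻ y : Unit → EuclideanSpace ℝ (Fin d),
            ∫⁻ v, k 1 (a () * ‖y ()‖ * planarRadius hd v) ∂μ ∂_ =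
          ∫⁻ y : Unit → EuclideanSpace ℝ (Fin d), ∫⁻ v, planarKernel d 1 (a () * ‖y ()‖ * ‖v‖) ∂μ ∂_
        rw [h1, h2]
        refine lintegral_congr fun p => ?_
        rcases (norm_nonneg (p ())).eq_or_lt with h0 | h0
        · simp [← h0, k, planarKernel]
        · exact hgauss (mul_pos (ha ()) h0))
    rw [← hev.map_eq]
    rw [ae_map_iff hev.measurable.aemeasurable]
    · exact h
    · exact measurableSet_eq_fun
        (Measurable.lintegral_prod_right'
          (f := fun q : EuclideanSpace ℝ (Fin d) × EuclideanSpace ℝ (Fin d) =>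
            k 1 (‖q.1‖ * planarRadius hd q.2)) (by fun_prop))
        (Measurable.lintegral_prod_right'
          (f := fun q : EuclideanSpace ℝ (Fin d) × EuclideanSpace ℝ (Fin d) =>
            planarKernel d 1 (‖q.1‖ * ‖q.2‖)) (by fun_prop))
  -- otherwise the two sides differ on some `(x, b)`, whence on an open set of `y`
  by_contra hne
  have t1 : Filter.Tendsto (fun z => ∫⁻ v, k z (planarRadius hd v) ∂μ) (nhdsWithin x (Ioi x))
      (nhds (∫⁻ v, k x (planarRadius hd v) ∂μ)) :=
    tendsto_lintegral_filter_of_dominated_convergence (fun _ => 1)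
      (Filter.Eventually.of_forall fun z => by fun_prop)
      (Filter.Eventually.of_forall fun z => ae_of_all _ fun v => hk1 _ _) (by simp)
      (ae_of_all _ fun v => tendsto_indicator_Ioi _ _)
  have t2 : Filter.Tendsto (fun z => ∫⁻ v, planarKernel d z ‖v‖ ∂μ) (nhdsWithin x (Ioi x))
      (nhds (∫⁻ v, planarKernel d x ‖v‖ ∂μ)) :=
    tendsto_lintegral_filter_of_dominated_convergence (fun _ => 1)
      (Filter.Eventually.of_forall fun z => by fun_prop)
      (by
        filter_upwards [self_mem_nhdsWithin] with z hz
        exact ae_of_all _ fun v => planarKernel_le_one hd (hx.trans (le_of_lt hz)) _)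
      (by simp) (ae_of_all _ fun v => tendsto_planarKernel hd _ _)
  have hev : ∀ᶠ z in nhdsWithin x (Ioi x), ∫⁻ v, k z (planarRadius hd v) ∂μ ≠
      ∫⁻ v, planarKernel d z ‖v‖ ∂μ :=
    (t1.prodMk_nhds t2).eventually (isClosed_diagonal.isOpen_compl.mem_nhds hne)
  obtain ⟨b, hb, hsub⟩ := mem_nhdsGT_iff_exists_Ioo_subset.mp hev
  have : γ.IsOpenPosMeasure := volume_absolutelyContinuous_stdGaussian.isOpenPosMeasure
  have hopen : IsOpen {y : EuclideanSpace ℝ (Fin d) | 1 < b * ‖y‖ ∧ x * ‖y‖ < 1} :=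
    (isOpen_lt (f := fun _ => 1) (g := fun y => b * ‖y‖) (by fun_prop) (by fun_prop)).inter
      (isOpen_lt (f := fun y => x * ‖y‖) (g := fun _ => 1) (by fun_prop) (by fun_prop))
  have hb' : x < b := hb
  obtain ⟨y, hy⟩ := exists_norm_eq (EuclideanSpace ℝ (Fin d)) (c := ((x + b) / 2)⁻¹)
    (inv_nonneg.mpr (by linarith))
  have hpos := hopen.measure_pos γ ⟨y, by
    rw [mem_ofPred_eq, hy, ← div_eq_mul_inv, ← div_eq_mul_inv, one_lt_div (by linarith),
      div_lt_one (by linarith)]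
    constructor <;> linarith⟩
  refine hpos.ne' (measure_mono_null ?_ hae)
  rintro w ⟨hw1, hw2⟩ heq
  have hw0 : 0 < ‖w‖ := by
    by_contra h
    have : ‖w‖ = 0 := le_antisymm (not_lt.mp h) (norm_nonneg w)
    rw [this, mul_zero] at hw1
    linarith
  refine hsub (a := 1 / ‖w‖) ⟨?_, ?_⟩ ?_
  · rwa [lt_div_iff₀ hw0]
  · rwa [div_lt_iff₀ hw0]
  · rw [mem_ofPred_eq] at heq
    simpa only [hkmul hw0, planarKernel_mul hw0] using heq

end PlanarProjection

/-! ### The law of the distance to the hyperplane -/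

section DistanceLaw

variable {d : ℕ}

/-- The set of linearly dependent systems of nonzero vectors is invariant under rescaling the
vectors, so the exchange of radii reduces its measure to the Gaussian case. -/
theorem ae_exists_eq_zero_or_det_ne_zero {μ : Measure (EuclideanSpace ℝ (Fin d))}
    [IsProbabilityMeasure μ] (hμ : IsSphericallySymmetric μ) :
    ∀ᵐ p ∂Measure.pi (fun _ : Fin d => μ), (∃ i, p i = 0) ∨ (rowMatrix p).det ≠ 0 := by
  let B : Set (Fin d → EuclideanSpace ℝ (Fin d)) :=
    {p | (∀ i, p i ≠ 0) ∧ (rowMatrix p).det = 0}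
  have hB : MeasurableSet B := by
    have h : B = (⋂ i, (fun p => p i) ⁻¹' {0}ᶜ) ∩ {p | (rowMatrix p).det = 0} := by
      ext p
      simp [B]
    rw [h]
    exact (MeasurableSet.iInter fun i =>
      (measurable_pi_apply i) (measurableSet_singleton (0 : EuclideanSpace ℝ (Fin d))).compl).inter
      (measurable_det_rowMatrix (measurableSet_singleton 0))
  have hscale {s : Fin d → ℝ} (hs : ∀ i, s i ≠ 0) (p : Fin d → EuclideanSpace ℝ (Fin d)) :
      (fun i => s i • p i) ∈ B ↔ p ∈ B := by
    have h : ∏ i, s i ≠ 0 := Finset.prod_ne_zero_iff.mpr fun i _ => hs i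
    change ((∀ i, s i • p i ≠ 0) ∧ (rowMatrix fun i => s i • p i).det = 0) ↔
      (∀ i, p i ≠ 0) ∧ (rowMatrix p).det = 0
    simp [det_rowMatrix_smul, hs, h]
  have hdet := ae_det_rowMatrix_ne_zero_stdGaussian (d := d)
  have hswap := lintegral_norm_smul_swap (μ := μ) (ν := stdGaussian _) hμ
    stdGaussian_map_linearIsometryEquiv (ι := Fin d) (F := B.indicator 1)
    (measurable_one.indicator hB)
  have hleft : ∀ᵐ y ∂Measure.pi (fun _ : Fin d => stdGaussian (EuclideanSpace ℝ (Fin d))),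
      ∫⁻ p, B.indicator (1 : (Fin d → EuclideanSpace ℝ (Fin d)) → ENNReal)
        (fun i => ‖y i‖ • p i) ∂Measure.pi (fun _ => μ) =
        Measure.pi (fun _ => μ) B := by
    filter_upwards [hdet] with y hy
    have hy0 (i : Fin d) : ‖y i‖ ≠ 0 := fun h =>
      hy (det_rowMatrix_eq_zero (norm_eq_zero.mp h))
    rw [← lintegral_indicator_one hB]
    refine lintegral_congr fun p => ?_
    simp only [indicator, hscale hy0, Pi.one_apply]
  have hright (p : Fin d → EuclideanSpace ℝ (Fin d)) :
      ∫⁻ y, B.indicator (1 : (Fin d → EuclideanSpace ℝ (Fin d)) → ENNReal) (fun i => ‖p i‖ • y i)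
        ∂Measure.pi (fun _ : Fin d => stdGaussian (EuclideanSpace ℝ (Fin d))) = 0 := by
    refine (lintegral_congr_ae ?_).trans lintegral_zero
    filter_upwards [hdet] with y hy
    refine indicator_of_notMem (fun h => ?_) _
    by_cases hp : ∀ i, ‖p i‖ ≠ 0
    · exact hy ((hscale hp y).mp h).2
    · push Not at hp
      obtain ⟨i, hi⟩ := hp
      exact h.1 i (by simp [hi])
  rw [lintegral_congr_ae hleft] at hswap
  simp only [hright, lintegral_const, measure_univ, mul_one] at hswap
  refine measure_mono_null (fun p hp => ?_) hswap
  have hp' : ¬((∃ i, p i = 0) ∨ (rowMatrix p).det ≠ 0) := hp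
  push Not at hp'
  exact hp'

theorem minPlanarRadius_eq_zero (hd : 2 ≤ d) {p : Fin d → EuclideanSpace ℝ (Fin d)} {i : Fin d}
    (hi : p i = 0) : minPlanarRadius hd p = 0 := by
  refine le_antisymm ?_ (minPlanarRadius_nonneg hd p)
  refine (Finset.inf'_le _ (Finset.mem_univ i)).trans ?_
  simp [planarRadius, hi]

theorem continuous_minPlanarRadius_smul (hd : 2 ≤ d) (p : Fin d → EuclideanSpace ℝ (Fin d)) :
    Continuous fun s : Fin d → ℝ => minPlanarRadius hd fun i => s i • p i := by
  refine Continuous.finset_inf'_apply _ fun i _ => ?_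
  unfold planarRadius
  fun_prop

theorem continuousOn_norm_dualVector_smul [NeZero d] {p : Fin d → EuclideanSpace ℝ (Fin d)}
    (hp : (∃ i, p i = 0) ∨ (rowMatrix p).det ≠ 0) :
    ContinuousOn (fun s : Fin d → ℝ => ‖dualVector (fun i => s i • p i) 1‖⁻¹)
      {s | ∀ i, 0 < s i} := by
  rcases hp with ⟨i, hi⟩ | hp
  · have (s : Fin d → ℝ) : dualVector (fun i => s i • p i) 1 = 0 :=
      dualVector_eq_zero (det_rowMatrix_eq_zero (i := i) (by simp [hi])) _
    simp only [this]
    exact continuousOn_const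
  · have hc : ContinuousOn (fun s : Fin d → ℝ => ‖dualVector p (fun i => 1 / s i)‖⁻¹)
        {s | ∀ i, 0 < s i} := by
      refine ContinuousOn.inv₀ ?_ fun s hs => ?_
      · refine ((continuous_dualVector_right p).comp_continuousOn ?_).norm
        refine continuousOn_pi.mpr fun i => ?_
        exact ContinuousOn.div continuousOn_const (continuous_apply i).continuousOn
          fun s hs => (hs i).ne'
      · rw [norm_ne_zero_iff]
        refine dualVector_ne_zero hp fun h => ?_
        exact one_div_ne_zero (hs 0).ne' (congrFun h 0)
    refine hc.congr fun s hs => ?_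
    simp only [dualVector_smul fun i => (hs i).ne', Pi.one_apply]

/-- For Gaussian points, the distance to the hyperplane has the law of the smallest planar radius
multiplied by `|cos θ|` with an independent uniform angle `θ`. -/
theorem lintegral_dualVector_stdGaussian_eq (hd : 2 ≤ d) {σ : Fin d → ℝ} (hσ : ∀ i, 0 ≤ σ i)
    {g : ℝ → ENNReal} (hg : Measurable g) :
    ∫⁻ y, g ‖dualVector (fun i => σ i • y i) 1‖⁻¹
        ∂Measure.pi (fun _ : Fin d => stdGaussian (EuclideanSpace ℝ (Fin d))) =
      ∫⁻ y, ∫⁻ θ, g (minPlanarRadius hd (fun i => σ i • y i) * |Real.cos θ|) ∂uniformAngle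
        ∂Measure.pi (fun _ : Fin d => stdGaussian (EuclideanSpace ℝ (Fin d))) := by
  have : NeZero d := ⟨by omega⟩
  by_cases h : ∀ i, 0 < σ i
  · simp only [dualVector_smul fun i => (h i).ne', Pi.one_apply, one_div]
    have hm : Measurable fun q : ℝ × ℝ => g (q.1 * |Real.cos q.2|) := by fun_prop
    rw [lintegral_dualVector_stdGaussian _ hg, lintegral_abs_gaussianReal
      (g := fun x => g (‖WithLp.toLp 2 fun i => (σ i)⁻¹‖⁻¹ * x)) (by fun_prop),
      lintegral_minPlanarRadius_stdGaussian hd h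
        (g := fun m => ∫⁻ θ, g (m * |Real.cos θ|) ∂uniformAngle) hm.lintegral_prod_right']
    simp only [mul_assoc]
  · push Not at h
    obtain ⟨i, hi⟩ := h
    have hi0 : σ i = 0 := le_antisymm hi (hσ i)
    have h1 (y : Fin d → EuclideanSpace ℝ (Fin d)) : dualVector (fun i => σ i • y i) 1 = 0 :=
      dualVector_eq_zero (det_rowMatrix_eq_zero (i := i) (by simp [hi0])) _
    have h2 (y : Fin d → EuclideanSpace ℝ (Fin d)) :
        minPlanarRadius hd (fun i => σ i • y i) = 0 :=
      minPlanarRadius_eq_zero hd (i := i) (by simp [hi0])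
    simp [h1, h2]

theorem measurable_norm_dualVector_smul : Measurable
    fun r : (Fin d → ℝ) × (Fin d → EuclideanSpace ℝ (Fin d)) =>
      ‖dualVector (fun i => r.1 i • r.2 i) 1‖⁻¹ := by
  have h : Measurable fun q : (Fin d → ℝ) × (Fin d → EuclideanSpace ℝ (Fin d)) =>
      fun i => q.1 i • q.2 i := by fun_prop
  exact ((measurable_dualVector 1).comp h).norm.inv

theorem measurable_minPlanarRadius_smul_mul_abs_cos (hd : 2 ≤ d) : Measurable
    fun r : (Fin d → ℝ) × ((Fin d → EuclideanSpace ℝ (Fin d)) × ℝ) =>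
      minPlanarRadius hd (fun i => r.1 i • r.2.1 i) * |Real.cos r.2.2| := by
  have h : Measurable fun r : (Fin d → ℝ) × ((Fin d → EuclideanSpace ℝ (Fin d)) × ℝ) =>
      minPlanarRadius hd (fun i => r.1 i • r.2.1 i) :=
    (measurable_minPlanarRadius hd).comp (by fun_prop)
  exact h.mul (by fun_prop)

theorem measurable_norm_dualVector_const_smul (s : Fin d → ℝ) :
    Measurable fun p : Fin d → EuclideanSpace ℝ (Fin d) =>
      ‖dualVector (fun i => s i • p i) 1‖⁻¹ := by
  have h : Measurable fun p : Fin d → EuclideanSpace ℝ (Fin d) => fun i => s i • p i := by fun_prop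
  exact ((measurable_dualVector 1).comp h).norm.inv

theorem measurable_minPlanarRadius_const_smul_mul_abs_cos (hd : 2 ≤ d) (s : Fin d → ℝ) :
    Measurable fun q : (Fin d → EuclideanSpace ℝ (Fin d)) × ℝ =>
      minPlanarRadius hd (fun i => s i • q.1 i) * |Real.cos q.2| := by
  have h : Measurable fun q : (Fin d → EuclideanSpace ℝ (Fin d)) × ℝ =>
      minPlanarRadius hd (fun i => s i • q.1 i) :=
    (measurable_minPlanarRadius hd).comp (by fun_prop)
  exact h.mul (by fun_prop)

/-- Averaged over Gaussian scaling factors, the distance to the hyperplane and the product of the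
smallest planar radius with `|cos θ|` agree in law, since exchanging the radii turns the isotropic
points into rescaled Gaussian ones. -/
theorem lintegral_dualVector_norm_smul (hd : 2 ≤ d) {μ : Measure (EuclideanSpace ℝ (Fin d))}
    [IsProbabilityMeasure μ] (hμ : IsSphericallySymmetric μ) {a : Fin d → ℝ} (ha : ∀ i, 0 ≤ a i)
    {g : ℝ → ENNReal} (hg : Measurable g) :
    ∫⁻ y, ∫⁻ p, g ‖dualVector (fun i => (a i * ‖y i‖) • p i) 1‖⁻¹ ∂Measure.pi (fun _ => μ)
        ∂Measure.pi (fun _ : Fin d => stdGaussian (EuclideanSpace ℝ (Fin d))) =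
      ∫⁻ y, ∫⁻ q, g (minPlanarRadius hd (fun i => (a i * ‖y i‖) • q.1 i) * |Real.cos q.2|)
          ∂(Measure.pi fun _ : Fin d => μ).prod uniformAngle
        ∂Measure.pi (fun _ : Fin d => stdGaussian (EuclideanSpace ℝ (Fin d))) := by
  have hDa := measurable_norm_dualVector_const_smul a
  have hM (s : Fin d → ℝ) : Measurable fun q : (Fin d → EuclideanSpace ℝ (Fin d)) × ℝ =>
      g (minPlanarRadius hd (fun i => s i • q.1 i) * |Real.cos q.2|) :=
    hg.comp (measurable_minPlanarRadius_const_smul_mul_abs_cos hd s)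
  have hMθ : Measurable fun p : Fin d → EuclideanSpace ℝ (Fin d) =>
      ∫⁻ θ, g (minPlanarRadius hd (fun i => a i • p i) * |Real.cos θ|) ∂uniformAngle :=
    (hM a).lintegral_prod_right'
  have s1 := lintegral_norm_smul_swap (μ := μ) (ν := stdGaussian _) hμ
    stdGaussian_map_linearIsometryEquiv (ι := Fin d)
    (F := fun p => g ‖dualVector (fun i => a i • p i) 1‖⁻¹) (hg.comp hDa)
  have s2 := lintegral_norm_smul_swap (μ := μ) (ν := stdGaussian _) hμ
    stdGaussian_map_linearIsometryEquiv (ι := Fin d)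
    (F := fun p => ∫⁻ θ, g (minPlanarRadius hd (fun i => a i • p i) * |Real.cos θ|) ∂uniformAngle)
    hMθ
  simp only [smul_smul] at s1 s2
  have e1 (p : Fin d → EuclideanSpace ℝ (Fin d)) := lintegral_dualVector_stdGaussian_eq hd
    (fun i => mul_nonneg (ha i) (norm_nonneg (p i))) hg
  have e2 (y : Fin d → EuclideanSpace ℝ (Fin d)) := lintegral_prod (μ := Measure.pi fun _ => μ)
    (ν := uniformAngle) _ (hM fun i => a i * ‖y i‖).aemeasurable
  simp only [e2, s1, s2, e1]

/-- The distance of the hyperplane through independent isotropic points from the origin has the law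
of the smallest planar radius multiplied by `|cos θ|`, with an independent uniform angle `θ`: the
two agree after averaging over Gaussian scaling factors, and Laplace inversion removes the
average. -/
theorem lintegral_dualVector_eq (hd : 2 ≤ d) {μ : Measure (EuclideanSpace ℝ (Fin d))}
    [IsProbabilityMeasure μ] (hμ : IsSphericallySymmetric μ) {g : ℝ → ENNReal} (hg : Continuous g)
    {C : ENNReal} (hC : C ≠ ⊤) (hgC : ∀ t, g t ≤ C) :
    ∫⁻ p, g ‖dualVector p 1‖⁻¹ ∂Measure.pi (fun _ : Fin d => μ) =
      ∫⁻ q, g (minPlanarRadius hd q.1 * |Real.cos q.2|)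
        ∂(Measure.pi (fun _ : Fin d => μ)).prod uniformAngle := by
  have : NeZero d := ⟨by omega⟩
  have : Nontrivial (EuclideanSpace ℝ (Fin d)) :=
    Module.nontrivial_of_finrank_pos (R := ℝ) (by rw [finrank_euclideanSpace_fin]; omega)
  have hD : Measurable fun r : (Fin d → ℝ) × (Fin d → EuclideanSpace ℝ (Fin d)) =>
      g ‖dualVector (fun i => r.1 i • r.2 i) 1‖⁻¹ :=
    hg.measurable.comp measurable_norm_dualVector_smul
  have hM : Measurable fun r : (Fin d → ℝ) × ((Fin d → EuclideanSpace ℝ (Fin d)) × ℝ) =>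
      g (minPlanarRadius hd (fun i => r.1 i • r.2.1 i) * |Real.cos r.2.2|) :=
    hg.measurable.comp (measurable_minPlanarRadius_smul_mul_abs_cos hd)
  have hDs (s : Fin d → ℝ) : Measurable fun p : Fin d → EuclideanSpace ℝ (Fin d) =>
      g ‖dualVector (fun i => s i • p i) 1‖⁻¹ :=
    hg.measurable.comp (measurable_norm_dualVector_const_smul s)
  have hMs (s : Fin d → ℝ) : Measurable fun q : (Fin d → EuclideanSpace ℝ (Fin d)) × ℝ =>
      g (minPlanarRadius hd (fun i => s i • q.1 i) * |Real.cos q.2|) :=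
    hg.measurable.comp (measurable_minPlanarRadius_const_smul_mul_abs_cos hd s)
  have key := eq_one_of_lintegral_norm_stdGaussian (E := EuclideanSpace ℝ (Fin d)) (C := C)
    (h₁ := fun s => ∫⁻ p, g ‖dualVector (fun i => s i • p i) 1‖⁻¹
      ∂Measure.pi (fun _ : Fin d => μ))
    (h₂ := fun s => ∫⁻ q, g (minPlanarRadius hd (fun i => s i • q.1 i) * |Real.cos q.2|)
      ∂(Measure.pi (fun _ : Fin d => μ)).prod uniformAngle)
    hD.lintegral_prod_right' hM.lintegral_prod_right' hC
    (fun s => (lintegral_mono fun ω => hgC _).trans (by simp))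
    (fun s => (lintegral_mono fun ω => hgC _).trans (by simp)) ?_ ?_
    fun a ha => lintegral_dualVector_norm_smul hd hμ (fun i => (ha i).le) hg.measurable
  · simpa only [Pi.one_apply, one_smul] using key
  · intro s hs
    refine tendsto_lintegral_filter_of_dominated_convergence (fun _ => C)
      (Filter.Eventually.of_forall hDs)
      (Filter.Eventually.of_forall fun s => ae_of_all _ fun p => hgC _) (by simp [hC]) ?_
    filter_upwards [ae_exists_eq_zero_or_det_ne_zero hμ] with p hp
    exact hg.continuousAt.comp_continuousWithinAt (continuousOn_norm_dualVector_smul hp s hs)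
  · intro s hs
    refine tendsto_lintegral_filter_of_dominated_convergence (fun _ => C)
      (Filter.Eventually.of_forall hMs)
      (Filter.Eventually.of_forall fun s => ae_of_all _ fun q => hgC _) (by simp [hC])
      (ae_of_all _ fun q => ?_)
    exact (hg.comp ((continuous_minPlanarRadius_smul hd q.1).mul
      continuous_const)).continuousWithinAt

theorem map_dualVector_eq (hd : 2 ≤ d) {μ : Measure (EuclideanSpace ℝ (Fin d))}
    [IsProbabilityMeasure μ] (hμ : IsSphericallySymmetric μ) :
    (Measure.pi (fun _ : Fin d => μ)).map (fun p => ‖dualVector p 1‖⁻¹) =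
      ((Measure.pi (fun _ : Fin d => μ)).prod uniformAngle).map
        (fun q => minPlanarRadius hd q.1 * |Real.cos q.2|) := by
  have hD : Measurable fun p : Fin d → EuclideanSpace ℝ (Fin d) => ‖dualVector p 1‖⁻¹ :=
    (measurable_dualVector 1).norm.inv
  have hM : Measurable fun q : (Fin d → EuclideanSpace ℝ (Fin d)) × ℝ =>
      minPlanarRadius hd q.1 * |Real.cos q.2| :=
    ((measurable_minPlanarRadius hd).comp measurable_fst).mul (by fun_prop)
  have : IsProbabilityMeasure
      ((Measure.pi (fun _ : Fin d => μ)).map (fun p => ‖dualVector p 1‖⁻¹)) :=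
    Measure.isProbabilityMeasure_map hD.aemeasurable
  refine ext_of_forall_lintegral_eq_of_IsFiniteMeasure fun g => ?_
  rw [lintegral_map (by fun_prop) hD, lintegral_map (by fun_prop) hM]
  exact lintegral_dualVector_eq hd hμ (ENNReal.continuous_coe.comp g.continuous)
    ENNReal.coe_ne_top
    fun t => ENNReal.coe_le_coe.mpr (BoundedContinuousFunction.NNReal.upper_bound g t)

end DistanceLaw

/-! ### Lebesgue-Stieltjes measures of tail functions -/

theorem tendsto_measure_Ioi (m : Measure ℝ) [IsFiniteMeasure m] (a : ℝ) :
    Filter.Tendsto (fun y => m.real (Ioi y)) (nhdsWithin a (Ioi a)) (nhds (m.real (Ioi a))) := by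
  refine (ENNReal.tendsto_toReal (measure_ne_top m _)).comp ?_
  simp only [← lintegral_indicator_one measurableSet_Ioi]
  exact tendsto_lintegral_filter_of_dominated_convergence (fun _ => 1)
    (Filter.Eventually.of_forall fun z => measurable_one.indicator measurableSet_Ioi)
    (Filter.Eventually.of_forall fun z => ae_of_all _ fun v =>
      indicator_apply_le' (fun _ => le_rfl) fun _ => zero_le_one) (by simp)
    (ae_of_all _ fun v => tendsto_indicator_Ioi _ _)

/-- Whichever convention is used at atoms, the tail function of `m` has Lebesgue-Stieltjes measure
`m`. -/
theorem stieltjesOfAntitone_eq {m : Measure ℝ} [IsFiniteMeasure m] {f : ℝ → ℝ} (hf : Antitone f)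
    (h1 : ∀ y, m.real (Ioi y) ≤ f y) (h2 : ∀ y, f y ≤ m.real (Ici y)) :
    stieltjesOfAntitone f hf = m := by
  have hlim (a : ℝ) : hf.neg.stieltjesFunction a = -m.real (Ioi a) := by
    rw [Monotone.stieltjesFunction_eq]
    refine rightLim_eq_of_tendsto (Filter.Tendsto.neg ?_)
    refine tendsto_of_tendsto_of_tendsto_of_le_of_le' (tendsto_measure_Ioi m a)
      tendsto_const_nhds (Filter.Eventually.of_forall h1) ?_
    filter_upwards [self_mem_nhdsWithin] with y hy
    exact (h2 y).trans (measureReal_mono (Ici_subset_Ioi.mpr hy))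
  refine Measure.ext_of_Ioc (hf.neg.stieltjesFunction.measure) m fun a b hab => ?_
  rw [StieltjesFunction.measure_Ioc, hlim, hlim, ← Ioc_union_Ioi_eq_Ioi hab.le,
    measureReal_union (Ioc_disjoint_Ioi le_rfl) measurableSet_Ioi]
  rw [show -m.real (Ioi b) - -(m.real (Ioc a b) + m.real (Ioi b)) = m.real (Ioc a b) by ring,
    ofReal_measureReal]

/-! ### The tail functions -/

section Tails

variable {d : ℕ} {μ : Measure (EuclideanSpace ℝ (Fin d))} [IsProbabilityMeasure μ]

/-- If a point is the origin, both sides vanish: the right one because then `dualVector` is zero. -/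
theorem ae_spanDist_eq [NeZero d] (hμ : IsSphericallySymmetric μ) :
    ∀ᵐ p ∂Measure.pi (fun _ : Fin d => μ), spanDist p = ‖dualVector p 1‖⁻¹ := by
  filter_upwards [ae_exists_eq_zero_or_det_ne_zero hμ] with p hp
  rcases hp with ⟨i, hi⟩ | hp
  · rw [spanDist_eq_zero hi, dualVector_eq_zero (det_rowMatrix_eq_zero hi), norm_zero, inv_zero]
  · exact spanDist_eq_of_det_ne_zero hp

theorem ae_affineIndependent (hμ : IsSphericallySymmetric μ) (h0 : μ {0} = 0) :
    ∀ᵐ p ∂Measure.pi (fun _ : Fin d => μ), AffineIndependent ℝ p := by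
  have hne : ∀ᵐ p ∂Measure.pi (fun _ : Fin d => μ), ∀ i, p i ≠ 0 :=
    ae_all_iff.mpr fun i =>
      (measurePreserving_eval (fun _ : Fin d => μ) i).quasiMeasurePreserving.ae
        (measure_eq_zero_iff_ae_notMem.mp h0)
  filter_upwards [ae_exists_eq_zero_or_det_ne_zero hμ, hne] with p hp hp0
  rcases hp with ⟨i, hi⟩ | hp
  · exact absurd hi (hp0 i)
  · exact affineIndependent_of_det_ne_zero hp

theorem measure_planarRadius_gt_zero (hd : 2 ≤ d) (hμ : IsSphericallySymmetric μ)
    (h0 : μ {0} = 0) : μ {v | 0 < planarRadius hd v} = 1 := by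
  rw [measure_planarRadius_gt hd hμ le_rfl]
  refine (lintegral_congr_ae (g := fun _ => 1) ?_).trans (by simp)
  filter_upwards [measure_eq_zero_iff_ae_notMem.mp h0] with v hv
  have : 0 < ‖v‖ := norm_pos_iff.mpr hv
  simp [planarKernel, this, lambdaFun]

theorem uniformAngle_mul_abs_cos_ge {x m : ℝ} (hx : 0 ≤ x) (hm : x < m) :
    uniformAngle {θ | x ≤ m * |Real.cos θ|} =
      ENNReal.ofReal (2 / Real.pi * Real.arccos (x / m)) := by
  have hm0 : 0 < m := hx.trans_lt hm
  rw [← uniformAngle_abs_cos_ge (div_nonneg hx hm0.le) ((div_le_one hm0).mpr hm.le)]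
  simp only [div_le_iff₀' hm0]

theorem uniformAngle_mul_abs_cos_ge_eq_zero {x m : ℝ} (hx : 0 < x) (hm : m ≤ x) :
    uniformAngle {θ | x ≤ m * |Real.cos θ|} = 0 := by
  refine measure_mono_null (t := {θ | 1 ≤ |Real.cos θ|}) (fun θ hθ => ?_) ?_
  · have h : x ≤ x * |Real.cos θ| :=
      (Set.mem_ofPred.mp hθ).trans (mul_le_mul_of_nonneg_right hm (abs_nonneg _))
    exact le_of_mul_le_mul_left (by simpa using h) hx
  · simpa using uniformAngle_abs_cos_ge zero_le_one le_rfl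

/-- The law of the distance of the hyperplane from the origin, as a mixture over the smallest planar
radius. -/
theorem measure_spanDist_ge (hd : 2 ≤ d) (hμ : IsSphericallySymmetric μ) {x : ℝ} (hx : 0 ≤ x)
    (h0 : x = 0 → μ {0} = 0) :
    Measure.pi (fun _ : Fin d => μ) {p | x ≤ spanDist p} =
      ∫⁻ m in Ioi x, ENNReal.ofReal (2 / Real.pi * Real.arccos (x / m))
        ∂(Measure.pi (fun _ : Fin d => μ)).map (minPlanarRadius hd) := by
  have : NeZero d := ⟨by omega⟩
  have hD : Measurable fun p : Fin d → EuclideanSpace ℝ (Fin d) => ‖dualVector p 1‖⁻¹ :=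
    (measurable_dualVector 1).norm.inv
  have hM : Measurable fun q : (Fin d → EuclideanSpace ℝ (Fin d)) × ℝ =>
      minPlanarRadius hd q.1 * |Real.cos q.2| :=
    ((measurable_minPlanarRadius hd).comp measurable_fst).mul (by fun_prop)
  have hdist : Measure.pi (fun _ : Fin d => μ) {p | x ≤ spanDist p} =
      ((Measure.pi (fun _ : Fin d => μ)).map fun p => ‖dualVector p 1‖⁻¹) (Ici x) := by
    rw [Measure.map_apply hD measurableSet_Ici]
    refine measure_congr ?_
    filter_upwards [ae_spanDist_eq hμ] with p hp
    exact congrArg (x ≤ ·) hp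
  rw [hdist, map_dualVector_eq hd hμ, Measure.map_apply hM measurableSet_Ici,
    Measure.prod_apply (hM measurableSet_Ici), ← lintegral_indicator measurableSet_Ioi,
    lintegral_map (Measurable.indicator (by fun_prop) measurableSet_Ioi)
      (measurable_minPlanarRadius hd)]
  -- for `x = 0` the angular event has probability `1` even when the radius is `0`, so the event of
  -- a vanishing radius has to be null
  have hpos : x = 0 → ∀ᵐ p ∂Measure.pi (fun _ : Fin d => μ), 0 < minPlanarRadius hd p := by
    intro hx0
    have hone := measure_pi_minPlanarRadius_gt hd (ν := fun _ => μ) 0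
    simp only [measure_planarRadius_gt_zero hd hμ (h0 hx0), Finset.prod_const_one] at hone
    exact (prob_compl_eq_zero_iff
      (measurableSet_lt measurable_const (measurable_minPlanarRadius hd))).mpr hone
  refine lintegral_congr_ae ?_
  have hpos' : ∀ᵐ p ∂Measure.pi (fun _ : Fin d => μ), x = 0 → 0 < minPlanarRadius hd p := by
    by_cases hx0 : x = 0
    · filter_upwards [hpos hx0] with p hp _ using hp
    · exact ae_of_all _ fun p h => absurd h hx0
  filter_upwards [hpos'] with p hp
  change uniformAngle {θ | x ≤ minPlanarRadius hd p * |Real.cos θ|} = _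
  by_cases h : x < minPlanarRadius hd p
  · rw [indicator_of_mem (mem_Ioi.mpr h), uniformAngle_mul_abs_cos_ge hx h]
  · rw [indicator_of_notMem (by simpa using h)]
    have hx0 : x ≠ 0 := fun hx0 => h (hx0 ▸ hp hx0)
    exact uniformAngle_mul_abs_cos_ge_eq_zero (hx.lt_of_ne hx0.symm) (not_lt.mp h)

/-- `K^d` is the tail function of the smallest planar radius of `d` independent points. -/
theorem stieltjesOfAntitone_planarTail_pow (hd : 2 ≤ d) :
    stieltjesOfAntitone (fun y => planarTail hd μ y ^ d) (planarTail_pow_antitone hd μ d) =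
      (Measure.pi (fun _ : Fin d => μ)).map (minPlanarRadius hd) := by
  have hm := measurable_minPlanarRadius hd
  have := Measure.isProbabilityMeasure_map (μ := Measure.pi (fun _ : Fin d => μ)) hm.aemeasurable
  have h (y : ℝ) : ((Measure.pi (fun _ : Fin d => μ)).map (minPlanarRadius hd)).real (Ioi y) =
      planarTail hd μ y ^ d := by
    rw [map_measureReal_apply hm measurableSet_Ioi, measureReal_def]
    have := measure_pi_minPlanarRadius_gt hd (ν := fun _ => μ) y
    rw [Finset.prod_const, Finset.card_univ, Fintype.card_fin] at this
    exact (congrArg ENNReal.toReal this).trans (ENNReal.toReal_pow _ _)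
  refine stieltjesOfAntitone_eq _ (fun y => (h y).le) fun y => ?_
  exact (h y).symm.trans_le (measureReal_mono Ioi_subset_Ici_self)

theorem stieltjesOfAntitone_radialTail :
    stieltjesOfAntitone (radialTail μ) (radialTail_antitone μ) = μ.map norm := by
  have := Measure.isProbabilityMeasure_map (μ := μ) measurable_norm.aemeasurable
  have h (y : ℝ) : (μ.map norm).real (Ici y) = radialTail μ y :=
    map_measureReal_apply measurable_norm measurableSet_Ici
  refine stieltjesOfAntitone_eq _ (fun y => ?_) fun y => (h y).ge
  exact (measureReal_mono Ioi_subset_Ici_self).trans (h y).le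

theorem planarTail_eq_integral (hd : 2 ≤ d) (hμ : IsSphericallySymmetric μ) {x : ℝ} (hx : 0 ≤ x) :
    planarTail hd μ x = ∫ y in Ioi x, lambdaFun d (x / y) ∂μ.map norm := by
  have hm : Measurable fun y : ℝ => lambdaFun d (x / y) :=
    measurable_lambdaFun.comp (by fun_prop)
  rw [integral_eq_lintegral_of_nonneg_ae _ hm.aestronglyMeasurable,
    ← lintegral_indicator measurableSet_Ioi,
    lintegral_map (hm.ennreal_ofReal.indicator measurableSet_Ioi) measurable_norm]
  · exact congrArg ENNReal.toReal (measure_planarRadius_gt hd hμ hx)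
  · filter_upwards [ae_restrict_mem measurableSet_Ioi] with y hy
    exact lambdaFun_nonneg (div_mem_Icc hx hy)

theorem measureReal_spanDist_ge (hd : 2 ≤ d) (hμ : IsSphericallySymmetric μ) {x : ℝ} (hx : 0 ≤ x)
    (h0 : x = 0 → μ {0} = 0) :
    (Measure.pi (fun _ : Fin d => μ)).real {p | x ≤ spanDist p} =
      2 / Real.pi * ∫ m in Ioi x, Real.arccos (x / m)
        ∂(Measure.pi (fun _ : Fin d => μ)).map (minPlanarRadius hd) := by
  rw [← integral_const_mul, integral_eq_lintegral_of_nonneg_ae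
    (ae_of_all _ fun m => mul_nonneg (by positivity) (Real.arccos_nonneg _))
    (by fun_prop), ← measure_spanDist_ge hd hμ hx h0, measureReal_def]

end Tails

theorem theorem1 {Ω : Type*} [MeasurableSpace Ω] (P : Measure Ω) [IsProbabilityMeasure P]
    (d N : ℕ) (hd : 2 ≤ d) (hN : d ≤ N)
    (μ : Measure (EuclideanSpace ℝ (Fin d))) [IsProbabilityMeasure μ]
    (hμ : IsSphericallySymmetric μ)
    (X : Fin N → Ω → EuclideanSpace ℝ (Fin d))
    (hlaw : ∀ i, HasLaw (X i) μ P) (hindep : iIndepFun X P) :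
    (μ {0} = 0 → ∀ᵐ ω ∂P, AffineIndependent ℝ (fun i : Fin d => X (Fin.castLE hN i) ω)) ∧
    (∀ x : ℝ, 0 ≤ x → (x = 0 → μ {0} = 0) →
      hyperplaneTail P (fun i : Fin d => X (Fin.castLE hN i)) x =
        2 / Real.pi * ∫ y in Ioi x, Real.arccos (x / y)
          ∂(stieltjesOfAntitone (fun y => planarTail hd μ y ^ d)
              (planarTail_pow_antitone hd μ d))) ∧
    (∀ x : ℝ, 0 ≤ x →
      planarTail hd μ x =
        ∫ y in Ioi x, lambdaFun d (x / y)
          ∂(stieltjesOfAntitone (radialTail μ) (radialTail_antitone μ))) := by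
  have : NeZero d := ⟨by omega⟩
  set Y : Ω → Fin d → EuclideanSpace ℝ (Fin d) := fun ω i => X (Fin.castLE hN i) ω
  have hY : AEMeasurable Y P := aemeasurable_pi_lambda _ fun i => (hlaw _).aemeasurable
  have hmap : P.map Y = Measure.pi fun _ : Fin d => μ := by
    have h := (iIndepFun_iff_map_fun_eq_pi_map fun i => (hlaw _).aemeasurable).mp
      (hindep.precomp (Fin.castLE_injective hN))
    simpa only [(hlaw _).map_eq] using h
  refine ⟨fun h0 => ?_, fun x hx h0 => ?_, fun x hx => ?_⟩
  · exact ae_of_ae_map hY (hmap ▸ ae_affineIndependent hμ h0)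
  · rw [stieltjesOfAntitone_planarTail_pow, ← measureReal_spanDist_ge hd hμ hx h0]
    have hs : NullMeasurableSet {p : Fin d → EuclideanSpace ℝ (Fin d) | x ≤ spanDist p}
        (P.map Y) := by
      rw [hmap]
      have hm : AEMeasurable spanDist (Measure.pi fun _ : Fin d => μ) :=
        ⟨_, (measurable_dualVector 1).norm.inv, ae_spanDist_eq hμ⟩
      exact nullMeasurableSet_le aemeasurable_const hm
    rw [← hmap, measureReal_def, Measure.map_apply₀ hY hs]
    rfl
  · rw [stieltjesOfAntitone_radialTail]
    exact planarTail_eq_integral hd hμ hx
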